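/- **Theorem (output synchronization).** Let $N\ge 1$, $M,p,q\ge 0$. Consider $N$ nodes and $M$ edges $$\dot x_i=A_ix_i+B_iu_i+D_iv_i,\quad y_i=C_ix_i\in\mathbb R^p\ (i\le N),\qquad \dot z_j=E_jz_j+F_js_j,\quad w_j=G_jz_j\in\mathbb R^p\ (j\le M),$$ coupled by $v_i=-\sum_{j}h_{ij}w_j$ and $s_j=\sum_{i}h_{ij}y_i$, where $H=(h_{ij})\in\mathbb R^{N\times M}$ is the incidence matrix of the network: edge $j$ joins two distinct nodes, with $h_{ij}=1$ if $i$ is its positive end, $h_{ij}=-1$ if $i$ is its negative end, and $h_{ij}=0$ otherwise. Let $S_\eta\in\mathbb R^{q\times q}$, $Q_\eta\in\mathbb R^{p\times q}$, $B_\eta\in\mathbb R^{q\times p}$, and for $\epsilon>0$ use the controller $$\dot\eta_i=S_\eta\eta_i+\epsilon B_\eta v_i,\qquad \dot\zeta_i=G_{1i}\zeta_i+G_{2i}(y_i-Q_\eta\eta_i),\qquad u_i=K_{xi}x_i+K_{\zeta i}\zeta_i .$$ Assume: * A1) all $B_i,D_i,F_j$ have full column rank and all $C_i,G_j$ have full row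 rank; * A2) all eigenvalues of $S_\eta$ lie on the imaginary axis and have algebraic multiplicity $1$; * A3) every edge system $(E_j,F_j,G_j)$ is strictly positive real: with $W_j(s)=G_j(sI-E_j)^{-1}F_j$ there is $\delta>0$ such that every eigenvalue of $E_j$ has real part at most $-\delta$, $W_j(s-\delta)+W_j(s-\delta)^*\succeq 0$ whenever $\operatorname{Re}s>0$, and this Hermitian matrix is nonsingular for at least one such $s$; * A4) the network is connected: $\operatorname{rank}H=N-1$; * every pair $(G_{1i},G_{2i})$ incorporates a $p$-copy internal model of $S_\eta$: $G_{1i}=T\begin{bmatrix}S_1&S_2\\0&\operatorname{diag}(\alpha_1,\dots,\alpha_p)\end{bmatrix}T^{-1}$ and $G_{2i}=T\begin{bmatrix}S_3\\ \operatorname{diag}(\beta_1,\dots,\beta_p)\end{bmatrix}$ for some invertible $T$ and matrices $S_1,S_2,S_3$, where each $(\alpha_k,\beta_k)$ is controllable with $\beta_k$ a column, and the minimal polynomial of $S_\eta$ divides the characteristic polynomial of each $\alpha_k$; * A5) for every $i$, with $\hat A_i=\begin{bmatrix}A_i+B_iK_{xi}&B_iK_{\zeta i}\\G_{2i}C_i&G_{1i}\end{bmatrix}$,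 $\hat D_i=\begin{bmatrix}D_i\\0\end{bmatrix}$, $\hat C_i=[\,C_i\ \ 0\,]$, the matrix $\hat A_i$ is Hurwitz and the system $\dot\xi=\hat A_i\xi+\hat D_iv$, $y=\hat C_i\xi$ is passive: there is a function $V\ge 0$ of the state with $V(\xi(T))\le V(\xi(0))+\int_0^T v^{\mathsf T}y\,dt$ for all $T\ge0$, all continuous inputs $v$ and all trajectories; * $B_\eta=P_\eta^{-1}Q_\eta^{\mathsf T}$ with $P_\eta$ symmetric positive definite and $P_\eta S_\eta+S_\eta^{\mathsf T}P_\eta\preceq 0$ (so that $(S_\eta,B_\eta,Q_\eta)$ is passive). Then there is $\epsilon^*>0$, depending only on these data, such that for every $0<\epsilon<\epsilon^*$ the controller solves the output synchronization problem: along every solution of the closed loop on $[0,\infty)$ there is a common trajectory $y_\eta=Q_\eta\eta_0$ with $\dot\eta_0=S_\eta\eta_0$ such that $y_i(t)-y_\eta(t)\to0$ as $t\to\infty$ for all $i$; and the common trajectory is nontrivial in the sense that, if $Q_\eta\ne0$, there is a closed-loop solution for which no $y_i(t)$ tends to $0$. Moreover, along every closed-loop solution, $$y_i(t)-Q_\eta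 e^{S_\eta t}\,\frac1N\sum_{k=1}^N\eta_k(0)\longrightarrow 0\quad(t\to\infty),\qquad i=1,\dots,N .$$ -/

import Mathlib

open Matrix Filter Topology Set
open scoped ComplexOrder

namespace DynamicEdgeNetwork

/-! ## Linear systems -/

/-- The entrywise complexification of a real matrix. -/
noncomputable abbrev cpx {m n : Type*} (A : Matrix m n ℝ) : Matrix m n ℂ :=
  A.map Complex.ofReal

/-- All (complex) eigenvalues of `A` have negative real part. -/
def IsHurwitz {n : Type*} [Fintype n] [DecidableEq n] (A : Matrix n n ℝ) : Prop :=
  ∀ l ∈ (cpx A).charpoly.roots, l.re < 0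

/-- All (complex) eigenvalues of `S` lie on the imaginary axis and have algebraic
multiplicity one. -/
def HasSimpleImaginarySpectrum {n : Type*} [Fintype n] [DecidableEq n]
    (S : Matrix n n ℝ) : Prop :=
  (∀ l ∈ (cpx S).charpoly.roots, l.re = 0) ∧
    ∀ l ∈ (cpx S).charpoly.roots, (cpx S).charpoly.rootMultiplicity l = 1

/-- `x` solves `x' = A x + B u` on `[0, ∞)` (with the one-sided derivative at `0`). -/
def IsStateTrajectory {n m : Type*} [Fintype n] [Fintype m]
    (A : Matrix n n ℝ) (B : Matrix n m ℝ) (u : ℝ → m → ℝ) (x : ℝ → n → ℝ) : Prop :=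
  ∀ t, 0 ≤ t → HasDerivWithinAt x (A *ᵥ x t + B *ᵥ u t) (Ici 0) t

/-- The linear system `x' = A x + B u`, `y = C x` is passive: there is a nonnegative storage
function `V` whose increase along every trajectory is at most the supplied energy `∫ uᵀ y`. -/
def IsPassive {n p : Type*} [Fintype n] [Fintype p]
    (A : Matrix n n ℝ) (B : Matrix n p ℝ) (C : Matrix p n ℝ) : Prop :=
  ∃ V : (n → ℝ) → ℝ, (∀ x, 0 ≤ V x) ∧
    ∀ (u : ℝ → p → ℝ) (x : ℝ → n → ℝ), Continuous u → IsStateTrajectory A B u x →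
      ∀ T, 0 ≤ T → V (x T) ≤ V (x 0) + ∫ t in (0 : ℝ)..T, u t ⬝ᵥ (C *ᵥ x t)

/-- The transfer function `C (s I - A)⁻¹ B`. -/
noncomputable def transferFunction {n p : Type*} [Fintype n] [DecidableEq n]
    (A : Matrix n n ℝ) (B : Matrix n p ℝ) (C : Matrix p n ℝ) (s : ℂ) : Matrix p p ℂ :=
  cpx C * (s • (1 : Matrix n n ℂ) - cpx A)⁻¹ * cpx B

/-- The linear system `(A, B, C)` with transfer function `H` is strictly positive real:
for some `δ > 0` the shifted function `s ↦ H (s - δ)` is positive real, that is, the system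
matrix `A + δ I` has no eigenvalue in the open right half-plane, and
`H (s - δ) + H (s - δ)ᴴ ≥ 0` there; moreover (the usual normal rank condition) this Hermitian
part is not everywhere singular. -/
def IsStrictlyPositiveReal {n p : Type*} [Fintype n] [DecidableEq n] [Fintype p] [DecidableEq p]
    (A : Matrix n n ℝ) (B : Matrix n p ℝ) (C : Matrix p n ℝ) : Prop :=
  ∃ δ : ℝ, 0 < δ ∧ (∀ l ∈ (cpx A).charpoly.roots, l.re ≤ -δ) ∧
    (∀ s : ℂ, 0 < s.re →
      (transferFunction A B C (s - δ) + (transferFunction A B C (s - δ))ᴴ).PosSemidef) ∧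
    ∃ s : ℂ, 0 < s.re ∧
      (transferFunction A B C (s - δ) + (transferFunction A B C (s - δ))ᴴ).det ≠ 0

/-- Controllability of a single-input pair: `b, a b, …, a ^ (d - 1) b` span the state space. -/
def IsControllablePair {d : ℕ} (a : Matrix (Fin d) (Fin d) ℝ) (b : Fin d → ℝ) : Prop :=
  Submodule.span ℝ (Set.range fun k : Fin d => (a ^ (k : ℕ)) *ᵥ b) = ⊤

/-- The pair `(G₁, G₂)` incorporates a `p`-copy internal model of `S`:
`G₁ = T [S₁ S₂; 0 diag(α₁, …, α_p)] T⁻¹` and `G₂ = T [S₃; diag(β₁, …, β_p)]` with `T` invertible,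
`(α_k, β_k)` controllable, and the minimal polynomial of `S` dividing the characteristic
polynomial of every `α_k`. -/
def IncorporatesInternalModel {q c p : ℕ} (S : Matrix (Fin q) (Fin q) ℝ)
    (G₁ : Matrix (Fin c) (Fin c) ℝ) (G₂ : Matrix (Fin c) (Fin p) ℝ) : Prop :=
  ∃ (r : ℕ) (d : Fin p → ℕ)
    (α : ∀ k, Matrix (Fin (d k)) (Fin (d k)) ℝ) (β : ∀ k, Fin (d k) → ℝ)
    (S₁ : Matrix (Fin r) (Fin r) ℝ) (S₂ : Matrix (Fin r) (Σ k, Fin (d k)) ℝ)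
    (S₃ : Matrix (Fin r) (Fin p) ℝ)
    (T : Matrix (Fin c) (Fin r ⊕ Σ k, Fin (d k)) ℝ)
    (Tinv : Matrix (Fin r ⊕ Σ k, Fin (d k)) (Fin c) ℝ),
    T * Tinv = 1 ∧ Tinv * T = 1 ∧
    G₁ = T * Matrix.fromBlocks S₁ S₂ 0 (Matrix.blockDiagonal' α) * Tinv ∧
    G₂ = T * Matrix.fromRows S₃ (Matrix.of fun a k => if a.1 = k then β a.1 a.2 else 0) ∧
    ∀ k, IsControllablePair (α k) (β k) ∧ minpoly ℝ S ∣ (α k).charpoly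

/-! ## Multi-agent systems with dynamic nodes and dynamic edges -/

/-- `N` node systems `(A i, B i, C i, D i)` and `M` edge systems `(E j, F j, G j)`, where edge `j`
has positive end `pos j` and negative end `neg j`. -/
structure MultiAgentSystem (N M p : ℕ) where
  n : Fin N → ℕ
  m : Fin N → ℕ
  ne : Fin M → ℕ
  A : ∀ i, Matrix (Fin (n i)) (Fin (n i)) ℝ
  B : ∀ i, Matrix (Fin (n i)) (Fin (m i)) ℝ
  C : ∀ i, Matrix (Fin p) (Fin (n i)) ℝ
  D : ∀ i, Matrix (Fin (n i)) (Fin p) ℝ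
  E : ∀ j, Matrix (Fin (ne j)) (Fin (ne j)) ℝ
  F : ∀ j, Matrix (Fin (ne j)) (Fin p) ℝ
  G : ∀ j, Matrix (Fin p) (Fin (ne j)) ℝ
  pos : Fin M → Fin N
  neg : Fin M → Fin N
  pos_ne_neg : ∀ j, pos j ≠ neg j

/-- Dimensions `c i` and gains of the dynamic controllers of the nodes. -/
structure ControllerGains {N M p : ℕ} (sys : MultiAgentSystem N M p) where
  c : Fin N → ℕ
  G₁ : ∀ i, Matrix (Fin (c i)) (Fin (c i)) ℝ
  G₂ : ∀ i, Matrix (Fin (c i)) (Fin p) ℝ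
  Kx : ∀ i, Matrix (Fin (sys.m i)) (Fin (sys.n i)) ℝ
  Kζ : ∀ i, Matrix (Fin (sys.m i)) (Fin (c i)) ℝ

namespace MultiAgentSystem

variable {N M p : ℕ} (sys : MultiAgentSystem N M p)

/-- The incidence matrix. -/
def H : Matrix (Fin N) (Fin M) ℝ :=
  Matrix.of fun i j => if i = sys.pos j then 1 else if i = sys.neg j then -1 else 0

/-- `B i`, `D i`, `F j` have full column rank; `C i`, `G j` have full row rank. -/
def FullRank : Prop :=
  (∀ i, (sys.B i).rank = sys.m i ∧ (sys.D i).rank = p ∧ (sys.C i).rank = p) ∧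
    ∀ j, (sys.F j).rank = p ∧ (sys.G j).rank = p

/-- The network is connected: the incidence matrix has rank `N - 1` (in particular `N ≥ 1`). -/
def IsConnected : Prop := sys.H.rank + 1 = N

end MultiAgentSystem

namespace ControllerGains

variable {N M p : ℕ} {sys : MultiAgentSystem N M p} (K : ControllerGains sys)

/-- State matrix of node `i` in closed loop with its controller, in the state `(x i, ζ i)`. -/
def Ahat (i : Fin N) :
    Matrix (Fin (sys.n i) ⊕ Fin (K.c i)) (Fin (sys.n i) ⊕ Fin (K.c i)) ℝ :=
  Matrix.fromBlocks (sys.A i + sys.B i * K.Kx i) (sys.B i * K.Kζ i)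
    (K.G₂ i * sys.C i) (K.G₁ i)

/-- Input matrix from the neighboring input `v i` to the state `(x i, ζ i)`. -/
def Dhat (i : Fin N) : Matrix (Fin (sys.n i) ⊕ Fin (K.c i)) (Fin p) ℝ :=
  Matrix.fromRows (sys.D i) 0

/-- Output matrix from the state `(x i, ζ i)` to `y i`. -/
def Chat (i : Fin N) : Matrix (Fin p) (Fin (sys.n i) ⊕ Fin (K.c i)) ℝ :=
  Matrix.fromCols (sys.C i) 0

end ControllerGains

/-- The signals of the closed loop: node states `x`, inputs `u`, neighboring inputs `v` and
outputs `y`; edge states `z`, inputs `s` and outputs `w`; exosystem states `η` and controller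
states `ζ`. -/
structure Signals {N M p : ℕ} {sys : MultiAgentSystem N M p} (K : ControllerGains sys)
    (q : ℕ) where
  x : ∀ i, ℝ → Fin (sys.n i) → ℝ
  u : ∀ i, ℝ → Fin (sys.m i) → ℝ
  v : Fin N → ℝ → Fin p → ℝ
  y : Fin N → ℝ → Fin p → ℝ
  z : ∀ j, ℝ → Fin (sys.ne j) → ℝ
  s : Fin M → ℝ → Fin p → ℝ
  w : Fin M → ℝ → Fin p → ℝ
  η : Fin N → ℝ → Fin q → ℝ
  ζ : ∀ i, ℝ → Fin (K.c i) → ℝ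

/-- The signals form a solution on `[0, ∞)` of the multi-agent system in closed loop with the
adaptive-exosystem controller. -/
structure IsClosedLoopSolution {N M p q : ℕ} {sys : MultiAgentSystem N M p}
    (K : ControllerGains sys) (S : Matrix (Fin q) (Fin q) ℝ) (Bη : Matrix (Fin q) (Fin p) ℝ)
    (Q : Matrix (Fin p) (Fin q) ℝ) (ε : ℝ) (σ : Signals K q) : Prop where
  node_state : ∀ i t, 0 ≤ t → HasDerivWithinAt (σ.x i)
    (sys.A i *ᵥ σ.x i t + sys.B i *ᵥ σ.u i t + sys.D i *ᵥ σ.v i t) (Ici 0) t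
  node_output : ∀ i t, 0 ≤ t → σ.y i t = sys.C i *ᵥ σ.x i t
  edge_state : ∀ j t, 0 ≤ t → HasDerivWithinAt (σ.z j)
    (sys.E j *ᵥ σ.z j t + sys.F j *ᵥ σ.s j t) (Ici 0) t
  edge_output : ∀ j t, 0 ≤ t → σ.w j t = sys.G j *ᵥ σ.z j t
  neighboring_input : ∀ i t, 0 ≤ t → σ.v i t = -∑ j, sys.H i j • σ.w j t
  edge_input : ∀ j t, 0 ≤ t → σ.s j t = ∑ i, sys.H i j • σ.y i t
  exosystem : ∀ i t, 0 ≤ t → HasDerivWithinAt (σ.η i)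
    (S *ᵥ σ.η i t + ε • (Bη *ᵥ σ.v i t)) (Ici 0) t
  controller_state : ∀ i t, 0 ≤ t → HasDerivWithinAt (σ.ζ i)
    (K.G₁ i *ᵥ σ.ζ i t + K.G₂ i *ᵥ (σ.y i t - Q *ᵥ σ.η i t)) (Ici 0) t
  control_law : ∀ i t, 0 ≤ t → σ.u i t = K.Kx i *ᵥ σ.x i t + K.Kζ i *ᵥ σ.ζ i t

/-- The controller solves the output synchronization problem: along every closed-loop solution all
node outputs converge to one common trajectory `Q η₀`, with `η₀' = S η₀`; and, unless `Q = 0` (when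
every such trajectory vanishes), the common trajectory is nontrivial, in that it does not decay to
zero for all initial conditions. -/
def SolvesOutputSynchronization {N M p q : ℕ} {sys : MultiAgentSystem N M p}
    (K : ControllerGains sys) (S : Matrix (Fin q) (Fin q) ℝ) (Bη : Matrix (Fin q) (Fin p) ℝ)
    (Q : Matrix (Fin p) (Fin q) ℝ) (ε : ℝ) : Prop :=
  (∀ σ : Signals K q, IsClosedLoopSolution K S Bη Q ε σ →
    ∃ η₀ : ℝ → Fin q → ℝ, (∀ t, 0 ≤ t → HasDerivWithinAt η₀ (S *ᵥ η₀ t) (Ici 0) t) ∧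
      ∀ i, Tendsto (fun t => σ.y i t - Q *ᵥ η₀ t) atTop (𝓝 0)) ∧
  (Q ≠ 0 → ∃ σ : Signals K q, IsClosedLoopSolution K S Bη Q ε σ ∧
    ∀ i, ¬ Tendsto (σ.y i) atTop (𝓝 0))

end DynamicEdgeNetwork

/-!
The closed loop is linear, so it suffices to control its modes `exp (l t) • X` with `0 ≤ re l`.
At such a frequency every edge, being strictly positive real, absorbs power at least `c ‖w_j‖²`
with `c` independent of `l`; this uniformity is Harnack's inequality on the right half plane. The
internal model provides a solution `X_i` of the regulator equations, and relative to the manifold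
`ξ_i = X_i η_i` a node is a passive system perturbed, at order `ε`, by the adaptation of `η_i`, so
it supplies power at least `-ε b ‖v_i‖²`. The interconnection loses no power and each `v_i` is
bounded by the `w_j`, hence `w = 0` once `ε` is small. Then `v = 0` and `s = 0`, the outputs are
`Q η_i`, and connectedness makes them equal to a common `y`. A Jordan chain over such a mode would
give `∑ η_i* P η_i = ε y* ∑ v_i`, where the `v_i` belong to the next vector of the chain; but
`∑ v_i = 0` in every state of the network, so no chain exists. The same identity lets the average
of the `η_i` follow the exosystem undisturbed, and the deviation of the outputs from that average
contains decaying modes only.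
-/

namespace DynamicEdgeNetwork

/-! ## Linear algebra -/

section Eigenspaces

variable {R V W : Type*} [CommRing R] [AddCommGroup V] [Module R V] [AddCommGroup W] [Module R W]

theorem maxGenEigenspace_le_eigenspace_of_no_jordan_chain (f : Module.End R V) (μ : R)
    (h : ∀ x y, f y = μ • y → f x = μ • x + y → y = 0) :
    f.maxGenEigenspace μ ≤ f.eigenspace μ := by
  intro x hx
  obtain ⟨k, hk⟩ := (Module.End.mem_maxGenEigenspace f μ x).1 hx
  induction k generalizing x with
  | zero => simp_all
  | succ k ih =>
    rw [pow_succ] at hk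
    have hy := ih ((Module.End.mem_maxGenEigenspace f μ _).2 ⟨k, hk⟩) hk
    have hzero := h x _ (Module.End.mem_eigenspace_iff.1 hy) (by simp)
    rw [Module.End.mem_eigenspace_iff, ← sub_eq_zero]
    simpa using hzero

theorem eq_zero_of_forall_eigenvector_eq_zero {f : Module.End R V}
    (hf : ⨆ μ, f.eigenspace μ = ⊤) (g : V →ₗ[R] W)
    (hg : ∀ (μ : R) (x : V), x ≠ 0 → f x = μ • x → g x = 0) : g = 0 := by
  rw [← LinearMap.ker_eq_top, eq_top_iff, ← hf]
  refine iSup_le fun μ x hx => ?_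
  rcases eq_or_ne x 0 with rfl | hx0
  · exact zero_mem _
  · exact hg μ x hx0 (Module.End.mem_eigenspace_iff.1 hx)

end Eigenspaces

section CharacteristicRoots

variable {k m n : Type*} [Field k] [Fintype n] [DecidableEq n]

theorem mem_roots_charpoly_iff_exists_eigenvector {A : Matrix n n k} {l : k} :
    l ∈ A.charpoly.roots ↔ ∃ x, x ≠ 0 ∧ A *ᵥ x = l • x := by
  rw [Polynomial.mem_roots A.charpoly_monic.ne_zero, Polynomial.IsRoot.def, eval_charpoly,
    ← exists_mulVec_eq_zero_iff]
  simp only [scalar_apply, ← smul_one_eq_diagonal, sub_mulVec, smul_mulVec, one_mulVec,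
    sub_eq_zero, eq_comm]

theorem resolvent_mulVec_eq_iff {A : Matrix n n k} {l : k} (hl : l ∉ A.charpoly.roots)
    {x y : n → k} : (l • (1 : Matrix n n k) - A)⁻¹ *ᵥ y = x ↔ l • x - A *ᵥ x = y := by
  have hunit : IsUnit (l • (1 : Matrix n n k) - A).det := by
    rw [smul_one_eq_diagonal, ← scalar_apply, ← eval_charpoly, isUnit_iff_ne_zero]
    exact fun h => hl ((Polynomial.mem_roots A.charpoly_monic.ne_zero).2 h)
  have happly : l • x - A *ᵥ x = (l • (1 : Matrix n n k) - A) *ᵥ x := by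
    rw [sub_mulVec, smul_mulVec, one_mulVec]
  rw [happly]
  constructor
  · rintro rfl
    rw [mulVec_mulVec, mul_nonsing_inv _ hunit, one_mulVec]
  · rintro rfl
    rw [mulVec_mulVec, nonsing_inv_mul _ hunit, one_mulVec]

variable [Fintype m] [DecidableEq m] [IsAlgClosed k]

theorem isUnit_aeval_charpoly_of_disjoint_roots {A : Matrix m m k} {B : Matrix n n k}
    (hAB : ∀ l ∈ A.charpoly.roots, l ∉ B.charpoly.roots) :
    IsUnit (Polynomial.aeval B A.charpoly) := by
  by_contra hunit
  rw [(IsAlgClosed.splits A.charpoly).eq_prod_roots_of_monic A.charpoly_monic] at hunit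
  obtain ⟨l, hlB, hlA⟩ := spectrum.exists_mem_of_not_isUnit_aeval_prod hunit
  exact hAB l ((Polynomial.mem_roots A.charpoly_monic.ne_zero).2 hlA)
    ((Polynomial.mem_roots B.charpoly_monic.ne_zero).2 (mem_spectrum_iff_isRoot_charpoly.1 hlB))

theorem exists_sylvester_solution {A : Matrix m m k} {B : Matrix n n k}
    (hAB : ∀ l ∈ A.charpoly.roots, l ∉ B.charpoly.roots) (C : Matrix m n k) :
    ∃ X : Matrix m n k, A * X - X * B = C := by
  let L : Matrix m n k →ₗ[k] Matrix m n k :=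
    { toFun := fun X => A * X - X * B
      map_add' := fun X Y => by rw [Matrix.mul_add, Matrix.add_mul]; abel
      map_smul' := fun a X => by simp [smul_sub] }
  have intertwine {X : Matrix m n k} (hX : A * X = X * B) (p : Polynomial k) :
      Polynomial.aeval A p * X = X * Polynomial.aeval B p := by
    induction p using Polynomial.induction_on' with
    | add p q hp hq => simp only [map_add, Matrix.add_mul, Matrix.mul_add, hp, hq]
    | monomial d a =>
      have hpow : A ^ d * X = X * B ^ d := by
        induction d with
        | zero => simp
        | succ d ih =>
          rw [pow_succ, Matrix.mul_assoc, hX, ← Matrix.mul_assoc, ih, Matrix.mul_assoc, pow_succ]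
      simp [Polynomial.aeval_monomial, Algebra.algebraMap_eq_smul_one, hpow]
  have hinj : Function.Injective L := by
    refine (injective_iff_map_eq_zero L).2 fun X hX => ?_
    obtain ⟨U, hU⟩ := isUnit_aeval_charpoly_of_disjoint_roots hAB
    have h0 := intertwine (sub_eq_zero.1 hX) A.charpoly
    rw [aeval_self_charpoly, Matrix.zero_mul, ← hU] at h0
    calc X = X * (U : Matrix n n k) * (↑U⁻¹ : Matrix n n k) := by
          rw [Matrix.mul_assoc, Units.mul_inv, Matrix.mul_one]
      _ = 0 := by rw [← h0, Matrix.zero_mul]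
  exact LinearMap.injective_iff_surjective.1 hinj C

end CharacteristicRoots

section ComplexBounds

variable {m n : Type*} [Fintype n]

theorem exists_norm_mulVec_le [Fintype m] (A : Matrix m n ℂ) :
    ∃ a : ℝ, 0 ≤ a ∧ ∀ x, ‖A *ᵥ x‖ ≤ a * ‖x‖ :=
  ⟨‖A.mulVecLin.toContinuousLinearMap‖, norm_nonneg _,
    A.mulVecLin.toContinuousLinearMap.le_opNorm⟩

theorem norm_star_dotProduct_le (x y : n → ℂ) :
    ‖star x ⬝ᵥ y‖ ≤ Fintype.card n * ‖x‖ * ‖y‖ := by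
  have hterm (i : n) : ‖star x i * y i‖ ≤ ‖x‖ * ‖y‖ := by
    rw [norm_mul, Pi.star_apply, norm_star]
    exact mul_le_mul (norm_le_pi_norm x i) (norm_le_pi_norm y i) (norm_nonneg _) (norm_nonneg _)
  calc ‖star x ⬝ᵥ y‖ ≤ ∑ i, ‖star x i * y i‖ := norm_sum_le _ _
    _ ≤ ∑ _i : n, ‖x‖ * ‖y‖ := Finset.sum_le_sum fun i _ => hterm i
    _ = Fintype.card n * ‖x‖ * ‖y‖ := by simp [mul_assoc]

theorem exists_mul_norm_sq_le_of_posDef {A : Matrix n n ℂ} (hA : A.PosDef) :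
    ∃ c : ℝ, 0 < c ∧ ∀ x, c * ‖x‖ ^ 2 ≤ (star x ⬝ᵥ A *ᵥ x).re := by
  have hcont : Continuous fun x : n → ℂ => (star x ⬝ᵥ A *ᵥ x).re := by fun_prop
  obtain ⟨c, hc, hsphere⟩ := (isCompact_sphere (0 : n → ℂ) 1).exists_forall_le' hcont.continuousOn
    (a := 0) fun x hx => hA.re_dotProduct_pos (ne_zero_of_mem_unit_sphere ⟨x, hx⟩)
  refine ⟨c, hc, fun x => ?_⟩
  rcases eq_or_ne x 0 with rfl | hx
  · simp
  have hx' : ‖x‖ ≠ 0 := norm_ne_zero_iff.2 hx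
  have hscale : star ((‖x‖⁻¹ : ℂ) • x) ⬝ᵥ A *ᵥ ((‖x‖⁻¹ : ℂ) • x) =
      ((‖x‖⁻¹ ^ 2 : ℝ) : ℂ) * (star x ⬝ᵥ A *ᵥ x) := by
    rw [mulVec_smul, star_smul, smul_dotProduct, dotProduct_smul]
    simp [pow_two, mul_assoc]
  have hunit := hsphere ((‖x‖⁻¹ : ℂ) • x) (by simp [norm_smul, hx'])
  rwa [hscale, Complex.re_ofReal_mul, inv_pow, ← div_eq_inv_mul, le_div_iff₀ (by positivity)]
    at hunit

theorem smul_sub_smul_mulVec_ne_zero [DecidableEq n] {A : Matrix n n ℂ}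
    (hA : ∀ l ∈ A.charpoly.roots, l.re < 0) {r : ℝ} {l : ℂ} (hr : 0 ≤ r) (hl : 0 ≤ l.re)
    (hrl : r + ‖l‖ ≠ 0) {x : n → ℂ} (hx : x ≠ 0) : l • x - r • A *ᵥ x ≠ 0 := by
  refine sub_ne_zero.2 fun h => ?_
  rcases hr.eq_or_lt with rfl | hr
  · simp_all
  · have hev : A *ᵥ x = (r⁻¹ • l) • x := by
      rw [smul_assoc, h, inv_smul_smul₀ hr.ne']
    have hneg := hA _ (mem_roots_charpoly_iff_exists_eigenvector.2 ⟨x, hx, hev⟩)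
    rw [Complex.smul_re, smul_eq_mul] at hneg
    exact absurd hneg (not_lt.2 (by positivity))

theorem isCompact_homogeneous_halfPlane_sphere :
    IsCompact {w : ℝ × ℂ × (n → ℂ) | 0 ≤ w.1 ∧ 0 ≤ w.2.1.re ∧ w.1 + ‖w.2.1‖ = 1 ∧ ‖w.2.2‖ = 1} := by
  refine (isCompact_closedBall (0 : ℝ × ℂ × (n → ℂ)) 1).of_isClosed_subset ?_ ?_
  · simp only [ofPred_and]
    refine .inter (isClosed_le ?_ ?_) <| .inter (isClosed_le ?_ ?_) <|
      .inter (isClosed_eq ?_ ?_) (isClosed_eq ?_ ?_) <;> fun_prop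
  · rintro ⟨r, l, x⟩ ⟨hr, -, hsum, hx⟩
    have := norm_nonneg l
    simp only [mem_closedBall_zero_iff, Prod.norm_def, Real.norm_eq_abs, abs_of_nonneg hr]
    refine max_le ?_ (max_le ?_ hx.le) <;> dsimp only at * <;> linarith

theorem exists_mul_norm_le_norm_smul_sub_mulVec [DecidableEq n] {A : Matrix n n ℂ}
    (hA : ∀ l ∈ A.charpoly.roots, l.re < 0) :
    ∃ c : ℝ, 0 < c ∧ ∀ l : ℂ, 0 ≤ l.re → ∀ x,
      c * ((1 + ‖l‖) * ‖x‖) ≤ ‖l • x - A *ᵥ x‖ := by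
  -- Homogenising `l • x - A x` to `l • x - r • A x` lets `(r, l)` range over a compact set.
  have hcont : Continuous fun w : ℝ × ℂ × (n → ℂ) => ‖w.2.1 • w.2.2 - w.1 • A *ᵥ w.2.2‖ := by
    fun_prop
  obtain ⟨c, hc, hmin⟩ := isCompact_homogeneous_halfPlane_sphere.exists_forall_le'
    hcont.continuousOn (a := 0) fun w ⟨hr, hl, hsum, hx⟩ => norm_pos_iff.2 <|
      smul_sub_smul_mulVec_ne_zero hA hr hl (hsum ▸ one_ne_zero)
        (norm_ne_zero_iff.1 (hx ▸ one_ne_zero))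
  refine ⟨c, hc, fun l hl x => ?_⟩
  rcases eq_or_ne x 0 with rfl | hx
  · simp
  have hx' : 0 < ‖x‖ := norm_pos_iff.2 hx
  have hunit := hmin ((1 + ‖l‖)⁻¹, (1 + ‖l‖)⁻¹ • l, ‖x‖⁻¹ • x)
    ⟨by positivity, by rw [Complex.smul_re]; exact smul_nonneg (by positivity) hl,
      by rw [norm_smul, Real.norm_of_nonneg (by positivity)]; field_simp,
      by rw [norm_smul, norm_inv, norm_norm, inv_mul_cancel₀ hx'.ne']⟩
  have hscale : ((1 + ‖l‖)⁻¹ • l) • ‖x‖⁻¹ • x - (1 + ‖l‖)⁻¹ • A *ᵥ (‖x‖⁻¹ • x) =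
      ((1 + ‖l‖) * ‖x‖)⁻¹ • (l • x - A *ᵥ x) := by
    rw [mulVec_smul, smul_assoc, smul_comm l, smul_smul, smul_smul, ← smul_sub, mul_inv]
  dsimp only at hunit
  rwa [hscale, norm_smul, Real.norm_of_nonneg (by positivity), ← div_eq_inv_mul,
    le_div_iff₀ (by positivity)] at hunit

end ComplexBounds

section Complexification

variable {l m n : Type*}

theorem cpx_mul [Fintype m] (A : Matrix l m ℝ) (B : Matrix m n ℝ) : cpx (A * B) = cpx A * cpx B :=
  Matrix.map_mul (f := Complex.ofRealHom)

theorem cpx_transpose (A : Matrix l n ℝ) : cpx Aᵀ = (cpx A)ᴴ := by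
  ext; simp

theorem map_cpx_mulVec [Fintype m] (φ : ℂ →L[ℝ] ℝ) (A : Matrix l m ℝ) (x : m → ℂ) :
    (fun i => φ ((cpx A *ᵥ x) i)) = A *ᵥ fun k => φ (x k) := by
  funext i
  simp only [mulVec, dotProduct, map_sum, map_apply]
  refine Finset.sum_congr rfl fun k _ => ?_
  rw [← Complex.real_smul, map_smul, smul_eq_mul]

theorem cpx_mulVec_ofReal [Fintype m] (A : Matrix l m ℝ) (x : m → ℝ) :
    (cpx A *ᵥ fun k => (x k : ℂ)) = fun i => ((A *ᵥ x) i : ℂ) := by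
  funext i
  simp [mulVec, dotProduct]

open scoped MatrixOrder in
theorem posSemidef_cpx [Finite m] {A : Matrix m m ℝ} (hA : A.PosSemidef) : (cpx A).PosSemidef := by
  cases nonempty_fintype m
  classical
  obtain ⟨B, rfl⟩ := CStarAlgebra.nonneg_iff_eq_star_mul_self.mp hA.nonneg
  rw [star_eq_conjTranspose, conjTranspose_eq_transpose_of_trivial, cpx_mul, cpx_transpose]
  exact posSemidef_conjTranspose_mul_self _

theorem posDef_cpx [Finite m] {A : Matrix m m ℝ} (hA : A.PosDef) : (cpx A).PosDef := by
  cases nonempty_fintype m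
  classical
  have hdet : (cpx A).det = (A.det : ℂ) := (RingHom.map_det Complex.ofRealHom A).symm
  rw [(posSemidef_cpx hA.posSemidef).posDef_iff_det_ne_zero, hdet]
  exact_mod_cast hA.det_pos.ne'

end Complexification

/-! ## Linear differential equations -/

section RealLinearODE

variable {V n : Type*} [NormedAddCommGroup V] [NormedSpace ℝ V]

theorem linearODE_unique (A : V →L[ℝ] V) {X Y : ℝ → V}
    (hX : ∀ t, 0 ≤ t → HasDerivWithinAt X (A (X t)) (Ici 0) t)
    (hY : ∀ t, 0 ≤ t → HasDerivWithinAt Y (A (Y t)) (Ici 0) t) (h0 : X 0 = Y 0)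
    {t : ℝ} (ht : 0 ≤ t) : X t = Y t :=
  ODE_solution_unique_of_mem_Icc_right (v := fun _ x => A x) (s := fun _ => univ)
    (K := ‖A‖₊) (a := 0) (b := t)
    (fun _ _ => A.lipschitz.lipschitzOnWith)
    (fun s hs => ((hX s hs.1).continuousWithinAt).mono Icc_subset_Ici_self)
    (fun s hs => (hX s hs.1).mono (Ici_subset_Ici.2 hs.1)) (fun _ _ => mem_univ _)
    (fun s hs => ((hY s hs.1).continuousWithinAt).mono Icc_subset_Ici_self)
    (fun s hs => (hY s hs.1).mono (Ici_subset_Ici.2 hs.1)) (fun _ _ => mem_univ _)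
    h0 (right_mem_Icc.2 ht)

variable [Fintype n] [DecidableEq n]

theorem hasDerivAt_exp_smul_mulVec (S : Matrix n n ℝ) (x : n → ℝ) (t : ℝ) :
    HasDerivAt (fun t : ℝ => NormedSpace.exp (t • S) *ᵥ x)
      (S *ᵥ (NormedSpace.exp (t • S) *ᵥ x)) t := by
  let _ := Matrix.linftyOpNormedRing (n := n) (α := ℝ)
  let _ := Matrix.linftyOpNormedAlgebra (n := n) (α := ℝ) (R := ℝ)
  let applyTo : Matrix n n ℝ →L[ℝ] n → ℝ :=
    ((Matrix.mulVecBilin ℝ ℝ).flip x).toContinuousLinearMap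
  rw [mulVec_mulVec]
  exact applyTo.hasFDerivAt.comp_hasDerivAt t (hasDerivAt_exp_smul_const' (𝕂 := ℝ) S t)

theorem eq_exp_smul_mulVec {S : Matrix n n ℝ} {X : ℝ → n → ℝ}
    (hX : ∀ t, 0 ≤ t → HasDerivWithinAt X (S *ᵥ X t) (Ici 0) t) {t : ℝ} (ht : 0 ≤ t) :
    X t = NormedSpace.exp (t • S) *ᵥ X 0 :=
  linearODE_unique S.mulVecLin.toContinuousLinearMap hX
    (fun s _ => (hasDerivAt_exp_smul_mulVec S (X 0) s).hasDerivWithinAt) (by simp) ht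

end RealLinearODE

section ComplexLinearODE

variable {E F : Type*} [NormedAddCommGroup E] [NormedSpace ℂ E]
  [NormedAddCommGroup F] [NormedSpace ℂ F]

theorem exp_zero_smul_apply (A : E →L[ℂ] E) (x : E) : NormedSpace.exp ((0 : ℝ) • A) x = x := by
  simp

variable [FiniteDimensional ℂ E]

theorem hasDerivAt_exp_smul_apply (A : E →L[ℂ] E) (x : E) (t : ℝ) :
    HasDerivAt (fun t : ℝ => NormedSpace.exp (t • A) x) (A (NormedSpace.exp (t • A) x)) t := by
  have : CompleteSpace E := FiniteDimensional.complete ℂ E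
  exact ((ContinuousLinearMap.apply ℂ E x).restrictScalars ℝ).hasFDerivAt.comp_hasDerivAt t
    (hasDerivAt_exp_smul_const' (𝕂 := ℝ) A t)

theorem eq_exp_smul_apply {A : E →L[ℂ] E} {X : ℝ → E}
    (hX : ∀ t, 0 ≤ t → HasDerivWithinAt X (A (X t)) (Ici 0) t) {t : ℝ} (ht : 0 ≤ t) :
    X t = NormedSpace.exp (t • A) (X 0) :=
  linearODE_unique (A.restrictScalars ℝ) hX
    (fun s _ => (hasDerivAt_exp_smul_apply A (X 0) s).hasDerivWithinAt)
    (exp_zero_smul_apply A _).symm ht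

theorem exp_smul_apply_of_pow_sub_apply_eq_zero {A : E →L[ℂ] E} {l : ℂ} {k : ℕ} {x : E}
    (hx : ((A - l • 1) ^ k) x = 0) (t : ℝ) :
    NormedSpace.exp (t • A) x = Complex.exp (t * l) •
      ∑ m ∈ Finset.range k, ((m.factorial : ℂ)⁻¹ * (t : ℂ) ^ m) • ((A - l • 1) ^ m) x := by
  have : CompleteSpace E := FiniteDimensional.complete ℂ E
  let _ : NormedAlgebra ℚ (E →L[ℂ] E) := NormedAlgebra.restrictScalars ℚ ℂ _
  set B := A - l • (1 : E →L[ℂ] E) with hB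
  have hsplit : t • A = ((t : ℂ) * l) • (1 : E →L[ℂ] E) + (t : ℂ) • B := by
    rw [hB, smul_sub, smul_smul, add_sub_cancel]; ext; simp
  have hcomm : Commute (((t : ℂ) * l) • (1 : E →L[ℂ] E)) ((t : ℂ) • B) :=
    ((Commute.one_left B).smul_left _).smul_right _
  have hscalar : NormedSpace.exp (((t : ℂ) * l) • (1 : E →L[ℂ] E)) = Complex.exp (t * l) • 1 := by
    simpa only [Algebra.algebraMap_eq_smul_one, Complex.exp_eq_exp_ℂ] using
      (NormedSpace.algebraMap_exp_comm (𝔸 := E →L[ℂ] E) ((t : ℂ) * l)).symm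
  have hseries := (ContinuousLinearMap.apply ℂ E x).hasSum
    (NormedSpace.exp_series_hasSum_exp' (𝕂 := ℂ) ((t : ℂ) • B))
  simp only [ContinuousLinearMap.apply_apply, _root_.smul_apply, smul_pow, smul_smul] at hseries
  rw [hsplit, NormedSpace.exp_add_of_commute hcomm, hscalar, smul_mul_assoc, one_mul,
    _root_.smul_apply]
  congr 1
  refine hseries.unique (hasSum_sum_of_ne_finset_zero fun m hm => ?_)
  obtain ⟨r, rfl⟩ := Nat.exists_eq_add_of_le' (show k ≤ m by simpa using hm)
  rw [pow_add B, mul_apply_eq_comp, hx, map_zero, smul_zero]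

theorem exp_smul_apply_of_apply_eq_smul {A : E →L[ℂ] E} {l : ℂ} {x : E} (hx : A x = l • x)
    (t : ℝ) : NormedSpace.exp (t • A) x = Complex.exp (t * l) • x := by
  simpa using exp_smul_apply_of_pow_sub_apply_eq_zero (k := 1) (A := A) (l := l) (x := x)
    (by simp [hx]) t

theorem tendsto_exp_mul_mul_pow {l : ℂ} (hl : l.re < 0) (m : ℕ) :
    Tendsto (fun t : ℝ => Complex.exp (t * l) * (t : ℂ) ^ m) atTop (𝓝 0) := by
  rw [tendsto_zero_iff_norm_tendsto_zero]
  refine (tendsto_rpow_mul_exp_neg_mul_atTop_nhds_zero m (-l.re) (by linarith)).congr' ?_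
  filter_upwards [eventually_ge_atTop (0 : ℝ)] with t ht
  simp [Complex.norm_exp, abs_of_nonneg ht, mul_comm]

theorem tendsto_exp_smul_apply_of_mem_maxGenEigenspace {A : E →L[ℂ] E} {l : ℂ} (hl : l.re < 0)
    {x : E} (hx : x ∈ Module.End.maxGenEigenspace (A : E →ₗ[ℂ] E) l) :
    Tendsto (fun t : ℝ => NormedSpace.exp (t • A) x) atTop (𝓝 0) := by
  obtain ⟨k, hk⟩ := (Module.End.mem_maxGenEigenspace _ _ _).1 hx
  have hpow (j : ℕ) : ((A : E →ₗ[ℂ] E) - l • 1) ^ j = ((A - l • 1) ^ j : E →L[ℂ] E) := by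
    induction j with
    | zero => rfl
    | succ j ih => rw [pow_succ, pow_succ, ih]; rfl
  rw [hpow] at hk
  simp_rw [exp_smul_apply_of_pow_sub_apply_eq_zero hk, Finset.smul_sum]
  rw [← Finset.sum_const_zero (s := Finset.range k)]
  refine tendsto_finsetSum _ fun m _ => ?_
  have hterm := ((tendsto_exp_mul_mul_pow hl m).const_mul ((m.factorial : ℂ)⁻¹)).smul_const
    (((A - l • 1) ^ m) x)
  rw [mul_zero, zero_smul] at hterm
  exact hterm.congr fun t => by rw [smul_smul, mul_left_comm]

theorem tendsto_apply_exp_smul_of_unstable_modes (A : E →L[ℂ] E) (L : E →L[ℂ] F)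
    (hL : ∀ l : ℂ, 0 ≤ l.re → ∀ x, A x = l • x → L x = 0)
    (hA : ∀ l : ℂ, 0 ≤ l.re → ∀ x y, A y = l • y → A x = l • x + y → y = 0) (x : E) :
    Tendsto (fun t : ℝ => L (NormedSpace.exp (t • A) x)) atTop (𝓝 0) := by
  have hx : x ∈ ⨆ l : ℂ, Module.End.maxGenEigenspace (A : E →ₗ[ℂ] E) l := by
    rw [Module.End.iSup_maxGenEigenspace_eq_top]; trivial
  induction hx using Submodule.iSup_induction' with
  | zero => simp
  | add x y _ _ hx hy => simpa using hx.add hy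
  | mem l x hx =>
    by_cases hl : 0 ≤ l.re
    · have hAx : A x = l • x := Module.End.mem_eigenspace_iff.1
        (maxGenEigenspace_le_eigenspace_of_no_jordan_chain (A : E →ₗ[ℂ] E) l (hA l hl) hx)
      simp [exp_smul_apply_of_apply_eq_smul hAx, hL l hl x hAx]
    · rw [← map_zero L]
      exact (L.continuous.tendsto 0).comp
        (tendsto_exp_smul_apply_of_mem_maxGenEigenspace (not_le.1 hl) hx)

end ComplexLinearODE

section RealModes

variable {m n : Type*}

/-- The real signal `t ↦ φ (e^{l t} ξ)`, with `φ` a real-linear functional on `ℂ` such as the real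
or the imaginary part: the real trajectories carried by a mode of a complexified real system. -/
noncomputable def realMode (φ : ℂ →L[ℝ] ℝ) (l : ℂ) (ξ : n → ℂ) (t : ℝ) (k : n) : ℝ :=
  φ (Complex.exp (l * t) * ξ k)

variable (φ : ℂ →L[ℝ] ℝ) (l : ℂ) (ξ : n → ℂ)

theorem realMode_add (ξ' : n → ℂ) (t : ℝ) :
    realMode φ l (ξ + ξ') t = realMode φ l ξ t + realMode φ l ξ' t := by
  simp [funext_iff, realMode, mul_add]

theorem mulVec_realMode [Fintype n] (A : Matrix m n ℝ) (t : ℝ) :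
    A *ᵥ realMode φ l ξ t = realMode φ l (cpx A *ᵥ ξ) t := by
  have h := map_cpx_mulVec φ A (Complex.exp (l * t) • ξ)
  rw [mulVec_smul] at h
  exact h.symm

theorem continuous_realMode : Continuous (realMode φ l ξ) := by
  unfold realMode; fun_prop

theorem hasDerivAt_realMode [Finite n] (t : ℝ) :
    HasDerivAt (realMode φ l ξ) (realMode φ l (l • ξ) t) t := by
  cases nonempty_fintype n
  refine hasDerivAt_pi.2 fun k => ?_
  have hexp : HasDerivAt (fun z : ℂ => Complex.exp (l * z)) (Complex.exp (l * t) * l) (t : ℂ) := by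
    simpa using ((hasDerivAt_id (t : ℂ)).const_mul l).cexp
  refine (φ.hasFDerivAt.comp_hasDerivAt t (hexp.comp_ofReal.mul_const (ξ k))).congr_deriv ?_
  simp [realMode, mul_assoc]

end RealModes

/-! ## Strictly positive real transfer functions -/

section Harnack

open scoped ComplexConjugate

theorem norm_add_conj_sq (w b : ℂ) : ‖w + conj b‖ ^ 2 = ‖w - b‖ ^ 2 + 4 * w.re * b.re := by
  simp only [← Complex.normSq_eq_norm_sq, Complex.normSq_apply, Complex.add_re, Complex.add_im,
    Complex.sub_re, Complex.sub_im, Complex.conj_re, Complex.conj_im]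
  ring

theorem add_conj_ne_zero {w b : ℂ} (hw : 0 ≤ w.re) (hb : 0 < b.re) : w + conj b ≠ 0 := by
  intro h
  have hre := congrArg Complex.re h
  rw [Complex.add_re, Complex.conj_re, Complex.zero_re] at hre
  linarith

theorem norm_sub_div_add_conj_le_one {w b : ℂ} (hw : 0 ≤ w.re) (hb : 0 < b.re) :
    ‖(w - b) / (w + conj b)‖ ≤ 1 := by
  have hpos : 0 < ‖w + conj b‖ := norm_pos_iff.2 (add_conj_ne_zero hw hb)
  rw [norm_div, div_le_one hpos]
  refine le_of_sq_le_sq ?_ hpos.le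
  rw [norm_add_conj_sq]
  nlinarith [mul_nonneg hw hb.le]

theorem norm_sub_div_add_conj_lt_one {w b : ℂ} (hw : 0 < w.re) (hb : 0 < b.re) :
    ‖(w - b) / (w + conj b)‖ < 1 := by
  have hpos : 0 < ‖w + conj b‖ := norm_pos_iff.2 (add_conj_ne_zero hw.le hb)
  rw [norm_div, div_lt_one hpos]
  refine lt_of_pow_lt_pow_left₀ 2 hpos.le ?_
  rw [norm_add_conj_sq]
  nlinarith [mul_pos hw hb]

theorem re_add_conj_mul_div_one_sub_pos {a ζ : ℂ} (ha : 0 < a.re) (hζ : ‖ζ‖ < 1) :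
    0 < ((a + conj a * ζ) / (1 - ζ)).re := by
  have hne : (1 : ℂ) - ζ ≠ 0 := sub_ne_zero.2 fun h => by simp [← h] at hζ
  have hre : ((a + conj a * ζ) / (1 - ζ)).re =
      a.re * (1 - ‖ζ‖ ^ 2) / Complex.normSq (1 - ζ) := by
    rw [← Complex.normSq_eq_norm_sq, Complex.div_re]
    simp only [Complex.normSq_apply, Complex.add_re, Complex.mul_re, Complex.conj_re,
      Complex.conj_im, Complex.sub_re, Complex.one_re, Complex.add_im, Complex.mul_im,
      Complex.sub_im, Complex.one_im]
    ring
  rw [hre]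
  have hsq : ‖ζ‖ ^ 2 < 1 := pow_lt_one₀ (norm_nonneg ζ) hζ two_ne_zero
  exact div_pos (mul_pos ha (sub_pos.2 hsq)) (Complex.normSq_pos.2 hne)

variable {f : ℂ → ℂ} {a l : ℂ}

theorem schwarz_pick_rightHalfPlane (hd : DifferentiableOn ℂ f {l | 0 < l.re})
    (hf : ∀ l : ℂ, 0 < l.re → 0 ≤ (f l).re) (ha : 0 < a.re) (hfa : 0 < (f a).re) (hl : 0 < l.re) :
    ‖f l - f a‖ * ‖l + conj a‖ ≤ ‖l - a‖ * ‖f l + conj (f a)‖ := by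
  let ψ : ℂ → ℂ := fun ζ => (a + conj a * ζ) / (1 - ζ)
  let h : ℂ → ℂ := fun ζ => (f (ψ ζ) - f a) / (f (ψ ζ) + conj (f a))
  have hψre : ∀ ζ ∈ Metric.ball (0 : ℂ) 1, 0 < (ψ ζ).re := fun ζ hζ =>
    re_add_conj_mul_div_one_sub_pos ha (by simpa using hζ)
  have hψd : DifferentiableOn ℂ ψ (Metric.ball 0 1) :=
    DifferentiableOn.div (by fun_prop) (by fun_prop) fun ζ hζ =>
      sub_ne_zero.2 fun h => by simp [← h] at hζ
  have hfψ : DifferentiableOn ℂ (fun ζ => f (ψ ζ)) (Metric.ball 0 1) := hd.comp hψd hψre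
  have hhd : DifferentiableOn ℂ h (Metric.ball 0 1) :=
    (hfψ.sub_const _).div (hfψ.add_const _) fun ζ hζ => add_conj_ne_zero (hf _ (hψre ζ hζ)) hfa
  have hmaps : MapsTo h (Metric.ball 0 1) (Metric.closedBall 0 1) := fun ζ hζ =>
    mem_closedBall_zero_iff.2 (norm_sub_div_add_conj_le_one (hf _ (hψre ζ hζ)) hfa)
  have hψl : ψ ((l - a) / (l + conj a)) = l := by
    have hla : l + conj a ≠ 0 := add_conj_ne_zero hl.le ha
    have haa : a + conj a ≠ 0 := add_conj_ne_zero ha.le ha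
    have hden : 1 - (l - a) / (l + conj a) = (a + conj a) / (l + conj a) := by
      field_simp; ring
    simp only [ψ, hden]
    field_simp
    ring
  have hschwarz := Complex.norm_le_norm_of_mapsTo_ball hhd hmaps (by simp [h, ψ])
    (norm_sub_div_add_conj_lt_one hl ha)
  simp only [h, hψl, norm_div] at hschwarz
  rwa [div_le_div_iff₀ (norm_pos_iff.2 (add_conj_ne_zero (hf l hl) hfa))
    (norm_pos_iff.2 (add_conj_ne_zero hl.le ha))] at hschwarz

theorem harnack_rightHalfPlane (hd : DifferentiableOn ℂ f {l | 0 < l.re})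
    (hf : ∀ l : ℂ, 0 < l.re → 0 ≤ (f l).re) (ha : 0 < a.re) (hl : 0 < l.re) :
    l.re * a.re * (f a).re ≤ (f l).re * ‖l + conj a‖ ^ 2 := by
  rcases (hf a ha).eq_or_lt with h0 | hfa
  · rw [← h0, mul_zero]
    exact mul_nonneg (hf l hl) (by positivity)
  have hpick : ‖f l - f a‖ ^ 2 * ‖l + conj a‖ ^ 2 ≤ ‖l - a‖ ^ 2 * ‖f l + conj (f a)‖ ^ 2 := by
    rw [← mul_pow, ← mul_pow]
    exact pow_le_pow_left₀ (by positivity) (schwarz_pick_rightHalfPlane hd hf ha hfa hl) 2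
  have hsq : (f a).re ^ 2 ≤ ‖f l + conj (f a)‖ ^ 2 := by
    refine pow_le_pow_left₀ hfa.le (le_trans ?_ (Complex.re_le_norm _)) 2
    simpa using hf l hl
  have hmono : l.re * a.re * (f a).re ^ 2 ≤ l.re * a.re * ‖f l + conj (f a)‖ ^ 2 := by gcongr
  rw [eq_sub_of_add_eq (norm_add_conj_sq (f l) (f a)).symm,
    eq_sub_of_add_eq (norm_add_conj_sq l a).symm] at hpick
  refine le_of_mul_le_mul_right ?_ hfa
  nlinarith

end Harnack

section TransferFunction

variable {n p : Type*} [Fintype n] [DecidableEq n] [Fintype p]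
  {E : Matrix n n ℝ} {F : Matrix n p ℝ} {G : Matrix p n ℝ}

theorem transferFunction_mulVec_eq {l : ℂ} (hl : l ∉ (cpx E).charpoly.roots) {z : n → ℂ}
    {s : p → ℂ} (hz : l • z - cpx E *ᵥ z = cpx F *ᵥ s) :
    transferFunction E F G l *ᵥ s = cpx G *ᵥ z := by
  rw [transferFunction, ← mulVec_mulVec, ← mulVec_mulVec, (resolvent_mulVec_eq_iff hl).2 hz]

theorem differentiableAt_dotProduct_transferFunction (F : Matrix n p ℝ) (G : Matrix p n ℝ)
    (s : p → ℂ) {l : ℂ} (hl : l ∉ (cpx E).charpoly.roots) :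
    DifferentiableAt ℂ (fun l => star s ⬝ᵥ transferFunction E F G l *ᵥ s) l := by
  let _ := Matrix.linftyOpNormedRing (n := n) (α := ℂ)
  let _ := Matrix.linftyOpNormedAlgebra (n := n) (α := ℂ) (R := ℂ)
  have hunit : IsUnit (l • (1 : Matrix n n ℂ) - cpx E) := by
    rw [Polynomial.mem_roots (cpx E).charpoly_monic.ne_zero, ← mem_spectrum_iff_isRoot_charpoly,
      spectrum.notMem_iff, Algebra.algebraMap_eq_smul_one] at hl
    exact hl
  have hresolvent : DifferentiableAt ℂ (fun l : ℂ => (l • (1 : Matrix n n ℂ) - cpx E)⁻¹) l := by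
    simp_rw [nonsing_inv_eq_ringInverse]
    exact (differentiableAt_inverse (𝕜 := ℂ) hunit).comp l
      ((differentiableAt_id.smul_const _).sub_const _)
  let power : Matrix n n ℂ →ₗ[ℂ] ℂ :=
    { toFun := fun R => star s ⬝ᵥ (cpx G * R * cpx F) *ᵥ s
      map_add' := fun R R' => by simp [Matrix.mul_add, Matrix.add_mul, add_mulVec]
      map_smul' := fun a R => by simp [smul_mulVec] }
  exact power.toContinuousLinearMap.differentiableAt.comp l hresolvent

theorem IsHurwitz.exists_norm_transferFunction_le (hE : IsHurwitz E) (F : Matrix n p ℝ)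
    (G : Matrix p n ℝ) :
    ∃ k : ℝ, ∀ l : ℂ, 0 ≤ l.re → ∀ s,
      (1 + ‖l‖) * ‖transferFunction E F G l *ᵥ s‖ ≤ k * ‖s‖ := by
  obtain ⟨c, hc, hresolvent⟩ := exists_mul_norm_le_norm_smul_sub_mulVec hE
  obtain ⟨f, -, hF⟩ := exists_norm_mulVec_le (cpx F)
  obtain ⟨g, hg, hG⟩ := exists_norm_mulVec_le (cpx G)
  refine ⟨g * (f / c), fun l hl s => ?_⟩
  have hroot : l ∉ (cpx E).charpoly.roots := fun h => (hE l h).not_ge hl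
  set z := (l • (1 : Matrix n n ℂ) - cpx E)⁻¹ *ᵥ (cpx F *ᵥ s) with hz
  have hzs := (resolvent_mulVec_eq_iff hroot).1 hz.symm
  have hzle : (1 + ‖l‖) * ‖z‖ ≤ f / c * ‖s‖ := by
    rw [div_mul_eq_mul_div, le_div_iff₀' hc]
    exact (hresolvent l hl z).trans (hzs ▸ hF s)
  calc (1 + ‖l‖) * ‖transferFunction E F G l *ᵥ s‖ = (1 + ‖l‖) * ‖cpx G *ᵥ z‖ := by
        rw [transferFunction_mulVec_eq hroot hzs]
    _ ≤ (1 + ‖l‖) * (g * ‖z‖) := by gcongr; exact hG z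
    _ = g * ((1 + ‖l‖) * ‖z‖) := by ring
    _ ≤ g * (f / c * ‖s‖) := by gcongr
    _ = g * (f / c) * ‖s‖ := by ring

end TransferFunction

section StrictlyPositiveReal

theorem re_dotProduct_add_conjTranspose_mulVec {p : Type*} [Fintype p] (W : Matrix p p ℂ)
    (s : p → ℂ) : (star s ⬝ᵥ (W + Wᴴ) *ᵥ s).re = 2 * (star s ⬝ᵥ W *ᵥ s).re := by
  have hadjoint : star s ⬝ᵥ Wᴴ *ᵥ s = star (star s ⬝ᵥ W *ᵥ s) := by
    rw [star_dotProduct, star_mulVec, conjTranspose_conjTranspose, ← dotProduct_mulVec]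
  rw [add_mulVec, dotProduct_add, hadjoint, Complex.add_re, Complex.star_def, Complex.conj_re,
    two_mul]

variable {n p : Type*} [Fintype n] [DecidableEq n] [Fintype p]
  {E : Matrix n n ℝ} {F : Matrix n p ℝ} {G : Matrix p n ℝ}

theorem harnack_transferFunction {δ : ℝ} (hroots : ∀ l ∈ (cpx E).charpoly.roots, l.re ≤ -δ)
    (hpower : ∀ l : ℂ, 0 < l.re → ∀ s, 0 ≤ (star s ⬝ᵥ transferFunction E F G (l - δ) *ᵥ s).re)
    {a l : ℂ} (ha : 0 < a.re) (hl : 0 < l.re) (s : p → ℂ) :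
    l.re * a.re * (star s ⬝ᵥ transferFunction E F G (a - δ) *ᵥ s).re ≤
      (star s ⬝ᵥ transferFunction E F G (l - δ) *ᵥ s).re * ‖l + starRingEnd ℂ a‖ ^ 2 := by
  refine harnack_rightHalfPlane (f := fun l => star s ⬝ᵥ transferFunction E F G (l - δ) *ᵥ s)
    (fun l hl => ?_) (fun l hl => hpower l hl s) ha hl
  have hroot : l - δ ∉ (cpx E).charpoly.roots := fun hmem => by
    have hle := hroots _ hmem
    rw [Complex.sub_re, Complex.ofReal_re] at hle
    have hpos : 0 < l.re := hl
    linarith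
  exact ((differentiableAt_dotProduct_transferFunction F G s hroot).comp l
    (differentiableAt_id.sub_const _)).differentiableWithinAt

variable [DecidableEq p]

theorem IsStrictlyPositiveReal.isHurwitz (h : IsStrictlyPositiveReal E F G) : IsHurwitz E := by
  obtain ⟨δ, hδ, hroots, -⟩ := h
  exact fun l hl => (hroots l hl).trans_lt (neg_lt_zero.2 hδ)

theorem IsStrictlyPositiveReal.exists_input_strict (h : IsStrictlyPositiveReal E F G) :
    ∃ c : ℝ, 0 < c ∧ ∀ l : ℂ, 0 ≤ l.re → ∀ s,
      c * ‖s‖ ^ 2 ≤ (star s ⬝ᵥ transferFunction E F G l *ᵥ s).re * (1 + ‖l‖) ^ 2 := by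
  obtain ⟨δ, hδ, hroots, hpsd, a, ha, hdet⟩ := h
  have hpower (l : ℂ) (hl : 0 < l.re) (s : p → ℂ) :
      0 ≤ (star s ⬝ᵥ transferFunction E F G (l - δ) *ᵥ s).re := by
    have := (hpsd l hl).re_dotProduct_nonneg s
    rw [RCLike.re_eq_complex_re, re_dotProduct_add_conjTranspose_mulVec] at this
    exact nonneg_of_mul_nonneg_right this two_pos
  obtain ⟨c, hc, hcoercive⟩ :=
    exists_mul_norm_sq_le_of_posDef ((hpsd a ha).posDef_iff_det_ne_zero.2 hdet)
  simp only [re_dotProduct_add_conjTranspose_mulVec] at hcoercive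
  set d : ℂ := δ + starRingEnd ℂ a with hd
  refine ⟨δ * a.re * (c / 2) / (1 + ‖d‖) ^ 2, by positivity, fun l hl s => ?_⟩
  have hlδ : δ ≤ (l + δ).re := by simpa using hl
  have hharnack := harnack_transferFunction hroots hpower ha (hδ.trans_le hlδ) s
  have hpowl := hpower _ (hδ.trans_le hlδ) s
  rw [add_sub_cancel_right] at hharnack hpowl
  have hnorm : ‖l + δ + starRingEnd ℂ a‖ ≤ (1 + ‖d‖) * (1 + ‖l‖) := by
    rw [add_assoc, ← hd]
    nlinarith [norm_add_le l d, mul_nonneg (norm_nonneg d) (norm_nonneg l)]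
  have hpowa : c / 2 * ‖s‖ ^ 2 ≤ (star s ⬝ᵥ transferFunction E F G (a - δ) *ᵥ s).re := by
    linarith [hcoercive s]
  rw [div_mul_eq_mul_div, div_le_iff₀ (by positivity)]
  calc δ * a.re * (c / 2) * ‖s‖ ^ 2 = δ * a.re * (c / 2 * ‖s‖ ^ 2) := by ring
    _ ≤ (l + δ).re * a.re * (star s ⬝ᵥ transferFunction E F G (a - δ) *ᵥ s).re :=
      mul_le_mul (mul_le_mul_of_nonneg_right hlδ ha.le) hpowa (by positivity)
        (mul_nonneg (hδ.le.trans hlδ) ha.le)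
    _ ≤ _ := hharnack
    _ ≤ (star s ⬝ᵥ transferFunction E F G l *ᵥ s).re * ((1 + ‖d‖) * (1 + ‖l‖)) ^ 2 :=
      mul_le_mul_of_nonneg_left (pow_le_pow_left₀ (norm_nonneg _) hnorm 2) hpowl
    _ = _ := by ring

theorem IsStrictlyPositiveReal.eq_zero_of_re_nonpos (h : IsStrictlyPositiveReal E F G) {l : ℂ}
    (hl : 0 ≤ l.re) {s : p → ℂ} (hs : (star s ⬝ᵥ transferFunction E F G l *ᵥ s).re ≤ 0) :
    s = 0 := by
  obtain ⟨c, hc, hinput⟩ := h.exists_input_strict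
  have hle : c * ‖s‖ ^ 2 ≤ 0 :=
    (hinput l hl s).trans (mul_nonpos_of_nonpos_of_nonneg hs (by positivity))
  have hsq : ‖s‖ ^ 2 ≤ 0 := nonpos_of_mul_nonpos_right hle hc
  exact norm_eq_zero.1 (pow_eq_zero_iff two_ne_zero |>.1 (hsq.antisymm (by positivity)))

-- The input bound degrades and the transfer function decays at the same rate in `1 + ‖l‖`.
theorem IsStrictlyPositiveReal.exists_output_strict (h : IsStrictlyPositiveReal E F G) :
    ∃ c : ℝ, 0 < c ∧ ∀ l : ℂ, 0 ≤ l.re → ∀ s,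
      c * ‖transferFunction E F G l *ᵥ s‖ ^ 2 ≤
        (star s ⬝ᵥ transferFunction E F G l *ᵥ s).re := by
  obtain ⟨c, hc, hinput⟩ := h.exists_input_strict
  obtain ⟨k, hgain⟩ := h.isHurwitz.exists_norm_transferFunction_le F G
  refine ⟨c / (k ^ 2 + 1), by positivity, fun l hl s => ?_⟩
  set w := transferFunction E F G l *ᵥ s
  have hl1 : 0 < (1 + ‖l‖) ^ 2 := by positivity
  have hsq : ((1 + ‖l‖) * ‖w‖) ^ 2 ≤ (k * ‖s‖) ^ 2 :=
    pow_le_pow_left₀ (by positivity) (hgain l hl s) 2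
  have hpower : 0 ≤ (star s ⬝ᵥ w).re :=
    nonneg_of_mul_nonneg_left (le_trans (by positivity) (hinput l hl s)) hl1
  rw [div_mul_eq_mul_div, div_le_iff₀ (by positivity)]
  refine le_of_mul_le_mul_right ?_ hl1
  calc c * ‖w‖ ^ 2 * (1 + ‖l‖) ^ 2 = c * ((1 + ‖l‖) * ‖w‖) ^ 2 := by ring
    _ ≤ c * (k * ‖s‖) ^ 2 := by gcongr
    _ = k ^ 2 * (c * ‖s‖ ^ 2) := by ring
    _ ≤ k ^ 2 * ((star s ⬝ᵥ w).re * (1 + ‖l‖) ^ 2) :=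
      mul_le_mul_of_nonneg_left (hinput l hl s) (sq_nonneg k)
    _ ≤ (star s ⬝ᵥ w).re * (k ^ 2 + 1) * (1 + ‖l‖) ^ 2 := by nlinarith [mul_nonneg hpower hl1.le]

end StrictlyPositiveReal

/-! ## Passive systems -/

section Passivity

variable {n p : Type*} [Fintype n] [Fintype p]
  {A : Matrix n n ℝ} {B : Matrix n p ℝ} {C : Matrix p n ℝ}

theorem isStateTrajectory_realMode (φ : ℂ →L[ℝ] ℝ) {l : ℂ} {ξ : n → ℂ} {v : p → ℂ}
    (hξ : cpx A *ᵥ ξ + cpx B *ᵥ v = l • ξ) :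
    IsStateTrajectory A B (realMode φ l v) (realMode φ l ξ) := fun t _ => by
  rw [mulVec_realMode, mulVec_realMode, ← realMode_add, hξ]
  exact (hasDerivAt_realMode φ l ξ t).hasDerivWithinAt

theorem realMode_re_dotProduct_add_realMode_im_dotProduct (l : ℂ) (x y : p → ℂ) (t : ℝ) :
    realMode Complex.reCLM l x t ⬝ᵥ realMode Complex.reCLM l y t +
        realMode Complex.imCLM l x t ⬝ᵥ realMode Complex.imCLM l y t =
      Real.exp (2 * l.re * t) * (star x ⬝ᵥ y).re := by
  set e := Complex.exp (l * t) with he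
  have hnorm : Real.exp (2 * l.re * t) = e.re * e.re + e.im * e.im := by
    rw [← Complex.normSq_apply, Complex.normSq_eq_norm_sq, he, Complex.norm_exp, ← Real.exp_nat_mul]
    congr 1
    simp only [Complex.re_mul_ofReal, Nat.cast_ofNat]
    ring
  simp only [realMode, dotProduct, ← he, ← Finset.sum_add_distrib, Complex.re_sum, Finset.mul_sum,
    hnorm]
  refine Finset.sum_congr rfl fun i _ => ?_
  simp only [Complex.reCLM_apply, Complex.imCLM_apply, Complex.mul_re, Complex.mul_im,
    Pi.star_apply, Complex.star_def, Complex.conj_re, Complex.conj_im]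
  ring

theorem IsPassive.exists_nonneg_add_integral_power (h : IsPassive A B C) {l : ℂ} {ξ : n → ℂ}
    {v : p → ℂ} (hξ : cpx A *ᵥ ξ + cpx B *ᵥ v = l • ξ) :
    ∃ V₀ : ℝ, ∀ T, 0 ≤ T →
      0 ≤ V₀ + ∫ t in (0 : ℝ)..T, Real.exp (2 * l.re * t) * (star v ⬝ᵥ cpx C *ᵥ ξ).re := by
  obtain ⟨V, hV, hdissipation⟩ := h
  let power (φ : ℂ →L[ℝ] ℝ) (t : ℝ) : ℝ := realMode φ l v t ⬝ᵥ realMode φ l (cpx C *ᵥ ξ) t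
  have hintegrable (φ : ℂ →L[ℝ] ℝ) (T : ℝ) :
      IntervalIntegrable (power φ) MeasureTheory.volume 0 T :=
    ((continuous_realMode φ l v).dotProduct (continuous_realMode φ l _)).intervalIntegrable 0 T
  have hmode (φ : ℂ →L[ℝ] ℝ) (T : ℝ) (hT : 0 ≤ T) :
      0 ≤ V (realMode φ l ξ 0) + ∫ t in (0 : ℝ)..T, power φ t := by
    refine (hV (realMode φ l ξ T)).trans ?_
    simpa only [mulVec_realMode] using
      hdissipation _ _ (continuous_realMode φ l v) (isStateTrajectory_realMode φ hξ) T hT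
  refine ⟨V (realMode Complex.reCLM l ξ 0) + V (realMode Complex.imCLM l ξ 0), fun T hT => ?_⟩
  simp_rw [← realMode_re_dotProduct_add_realMode_im_dotProduct]
  rw [intervalIntegral.integral_add (hintegrable Complex.reCLM T) (hintegrable Complex.imCLM T)]
  linarith [hmode Complex.reCLM T hT, hmode Complex.imCLM T hT]

theorem IsPassive.re_nonneg (h : IsPassive A B C) {l : ℂ} (hl : 0 ≤ l.re) {ξ : n → ℂ} {v : p → ℂ}
    (hξ : cpx A *ᵥ ξ + cpx B *ᵥ v = l • ξ) : 0 ≤ (star v ⬝ᵥ cpx C *ᵥ ξ).re := by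
  obtain ⟨V₀, hV₀⟩ := h.exists_nonneg_add_integral_power hξ
  set r := (star v ⬝ᵥ cpx C *ᵥ ξ).re
  by_contra! hr
  have hlinear (T : ℝ) (hT : 0 ≤ T) : 0 ≤ V₀ + T * r := by
    refine (hV₀ T hT).trans (add_le_add_right ?_ V₀)
    have hmono : ∫ t in (0 : ℝ)..T, Real.exp (2 * l.re * t) * r ≤ ∫ _ in (0 : ℝ)..T, r := by
      refine intervalIntegral.integral_mono_on hT
        (Continuous.intervalIntegrable (by fun_prop) _ _) (by simp) fun t ht => ?_
      exact mul_le_of_one_le_left hr.le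
        (Real.one_le_exp (mul_nonneg (mul_nonneg zero_le_two hl) ht.1))
    simpa using hmono
  have hV₀nonneg : 0 ≤ V₀ := by simpa using hlinear 0 le_rfl
  have hlate := hlinear ((V₀ + 1) / -r) (div_nonneg (by linarith) (by linarith))
  rw [div_neg, neg_mul, div_mul_cancel₀ _ hr.ne] at hlate
  linarith

end Passivity

section LyapunovMatrix

variable {n p : Type*} [Fintype n]

theorem star_dotProduct_mulVec_mulVec_of_mul_eq_conjTranspose [Fintype p] {P : Matrix n n ℂ}
    {B : Matrix n p ℂ} {C : Matrix p n ℂ} (hB : P * B = Cᴴ) (x : n → ℂ) (u : p → ℂ) :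
    star x ⬝ᵥ P *ᵥ (B *ᵥ u) = star (C *ᵥ x) ⬝ᵥ u := by
  rw [mulVec_mulVec, hB, dotProduct_mulVec, star_mulVec]

theorem cpx_mul_cpx_inv_mul_transpose [DecidableEq n] {P : Matrix n n ℝ} (hP : P.PosDef)
    (Q : Matrix p n ℝ) : cpx P * cpx (P⁻¹ * Qᵀ) = (cpx Q)ᴴ := by
  rw [← cpx_mul, ← Matrix.mul_assoc, mul_nonsing_inv _ ((isUnit_iff_isUnit_det P).1 hP.isUnit),
    Matrix.one_mul, cpx_transpose]

/-- The quadratic form of the positive definite matrix `P` does not increase along the solutions of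
`x' = A x`: the storage function of a passive linear system, over `ℂ` so that it applies to
exponential modes. -/
structure IsLyapunovMatrix (P A : Matrix n n ℂ) : Prop where
  posDef : P.PosDef
  dissipative : (-(P * A + Aᴴ * P)).PosSemidef

theorem isLyapunovMatrix_cpx {P S : Matrix n n ℝ} (hP : P.PosDef)
    (hPS : (-(P * S + Sᵀ * P)).PosSemidef) : IsLyapunovMatrix (cpx P) (cpx S) where
  posDef := posDef_cpx hP
  dissipative := by
    rw [← cpx_transpose, ← cpx_mul, ← cpx_mul]
    convert posSemidef_cpx hPS
    ext
    simp

namespace IsLyapunovMatrix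

variable {P A : Matrix n n ℂ} {l : ℂ}

theorem star_dotProduct_mulVec_comm (h : IsLyapunovMatrix P A) (x y : n → ℂ) :
    star x ⬝ᵥ P *ᵥ y = star (P *ᵥ x) ⬝ᵥ y := by
  rw [star_mulVec, ← dotProduct_mulVec, h.posDef.isHermitian]

theorem re_star_dotProduct_mulVec_nonpos (h : IsLyapunovMatrix P A) (x : n → ℂ) :
    (star x ⬝ᵥ P *ᵥ (A *ᵥ x)).re ≤ 0 := by
  have hdissipative := h.dissipative.re_dotProduct_nonneg x
  have hadjoint : Aᴴ * P = (P * A)ᴴ := by rw [conjTranspose_mul, h.posDef.isHermitian]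
  rw [hadjoint, neg_mulVec, dotProduct_neg, map_neg, RCLike.re_eq_complex_re,
    re_dotProduct_add_conjTranspose_mulVec, ← mulVec_mulVec] at hdissipative
  linarith

theorem re_nonneg [Fintype p] (h : IsLyapunovMatrix P A) {B : Matrix n p ℂ} {C : Matrix p n ℂ}
    (hB : P * B = Cᴴ) (hl : 0 ≤ l.re) {x : n → ℂ} {u : p → ℂ}
    (hx : A *ᵥ x + B *ᵥ u = l • x) : 0 ≤ (star u ⬝ᵥ C *ᵥ x).re := by
  have hstored := h.posDef.posSemidef.dotProduct_mulVec_nonneg x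
  have hbalance : l * (star x ⬝ᵥ P *ᵥ x) =
      star x ⬝ᵥ P *ᵥ (A *ᵥ x) + star (C *ᵥ x) ⬝ᵥ u := by
    rw [← star_dotProduct_mulVec_mulVec_of_mul_eq_conjTranspose hB, ← dotProduct_add, ← mulVec_add,
      hx, mulVec_smul, dotProduct_smul, smul_eq_mul]
  have hre := congrArg Complex.re hbalance
  rw [Complex.mul_re, ← (Complex.nonneg_iff.1 hstored).2, mul_zero, sub_zero, Complex.add_re] at hre
  rw [star_dotProduct, Complex.star_def, Complex.conj_re]
  linarith [mul_nonneg hl (Complex.nonneg_iff.1 hstored).1, h.re_star_dotProduct_mulVec_nonpos x]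

theorem conjTranspose_mulVec_of_eigenvector (h : IsLyapunovMatrix P A) (hl : l.re = 0)
    {φ : n → ℂ} (hφ : A *ᵥ φ = l • φ) : Aᴴ *ᵥ (P *ᵥ φ) = -(l • P *ᵥ φ) := by
  have hconj : star l = -l := by apply Complex.ext <;> simp [hl]
  have hpower : star φ ⬝ᵥ Aᴴ *ᵥ (P *ᵥ φ) = -l * (star φ ⬝ᵥ P *ᵥ φ) := by
    rw [dotProduct_mulVec, ← star_mulVec, hφ, star_smul, hconj, smul_dotProduct, smul_eq_mul]
  have hzero := (h.dissipative.dotProduct_mulVec_zero_iff φ).1 (by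
    rw [neg_mulVec, add_mulVec, ← mulVec_mulVec, ← mulVec_mulVec, dotProduct_neg, dotProduct_add,
      hpower, hφ, mulVec_smul, dotProduct_smul, smul_eq_mul]
    ring)
  rw [neg_mulVec, neg_eq_zero, add_mulVec, ← mulVec_mulVec, ← mulVec_mulVec, hφ,
    mulVec_smul] at hzero
  exact (neg_eq_of_add_eq_zero_right hzero).symm

theorem star_dotProduct_eq_zero_of_eigenvector (h : IsLyapunovMatrix P A) (hl : l.re = 0)
    {φ : n → ℂ} (hφ : A *ᵥ φ = l • φ) (x : n → ℂ) :
    star φ ⬝ᵥ P *ᵥ (A *ᵥ x - l • x) = 0 := by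
  have hconj : star l = -l := by apply Complex.ext <;> simp [hl]
  have hleft : star (P *ᵥ φ) ᵥ* A = l • star (P *ᵥ φ) := by
    rw [← star_inj, star_vecMul, star_star, h.conjTranspose_mulVec_of_eigenvector hl hφ, star_smul,
      star_star, hconj, neg_smul]
  rw [h.star_dotProduct_mulVec_comm, dotProduct_sub, dotProduct_mulVec, hleft, smul_dotProduct,
    dotProduct_smul, sub_self]

theorem eq_zero_of_jordan_chain (h : IsLyapunovMatrix P A) (hl : l.re = 0) {x φ : n → ℂ}
    (hφ : A *ᵥ φ = l • φ) (hx : A *ᵥ x = l • x + φ) : φ = 0 := by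
  have horthogonal := h.star_dotProduct_eq_zero_of_eigenvector hl hφ x
  rw [hx, add_sub_cancel_left] at horthogonal
  by_contra hne
  exact (h.posDef.dotProduct_mulVec_pos hne).ne' horthogonal

theorem iSup_eigenspace_eq_top [DecidableEq n] (h : IsLyapunovMatrix P A)
    (hre : ∀ l ∈ A.charpoly.roots, l.re = 0) :
    ⨆ l, Module.End.eigenspace (toLin' A) l = ⊤ := by
  rw [eq_top_iff, ← Module.End.iSup_maxGenEigenspace_eq_top (toLin' A)]
  refine iSup_mono fun l => maxGenEigenspace_le_eigenspace_of_no_jordan_chain _ _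
    fun x φ hφ hx => ?_
  by_contra hne
  exact hne (h.eq_zero_of_jordan_chain
    (hre l (mem_roots_charpoly_iff_exists_eigenvector.2 ⟨φ, hne, hφ⟩)) hφ hx)

end IsLyapunovMatrix

end LyapunovMatrix

/-! ## Internal models -/

section InternalModel

-- Half of the Popov–Belevitch–Hautus test.
theorem IsControllablePair.eq_zero_of_left_eigenvector {d : ℕ} {a : Matrix (Fin d) (Fin d) ℝ}
    {b : Fin d → ℝ} (h : IsControllablePair a b) {l : ℂ} {ψ : Fin d → ℂ}
    (hψ : ψ ᵥ* cpx a = l • ψ) (hb : (ψ ⬝ᵥ fun i => (b i : ℂ)) = 0) : ψ = 0 := by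
  have hpow (k : ℕ) : (ψ ⬝ᵥ fun i => ((a ^ k *ᵥ b) i : ℂ)) = 0 := by
    induction k with
    | zero => simpa using hb
    | succ k ih =>
      rw [pow_succ', ← mulVec_mulVec, ← cpx_mulVec_ofReal, dotProduct_mulVec, hψ, smul_dotProduct,
        ih, smul_zero]
  have hall (x : Fin d → ℝ) : (ψ ⬝ᵥ fun i => (x i : ℂ)) = 0 := by
    have hx : x ∈ Submodule.span ℝ (Set.range fun k : Fin d => a ^ (k : ℕ) *ᵥ b) :=
      h ▸ Submodule.mem_top
    induction hx using Submodule.span_induction with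
    | mem x hx => obtain ⟨k, rfl⟩ := hx; exact hpow k
    | zero => simp [dotProduct]
    | add x y _ _ hx hy =>
      simpa [dotProduct, mul_add, Finset.sum_add_distrib] using congrArg₂ (· + ·) hx hy
    | smul r x _ hx =>
      simpa [dotProduct, Finset.mul_sum, mul_left_comm] using congrArg ((r : ℂ) * ·) hx
  ext i
  simpa [dotProduct, Pi.single_apply, apply_ite Complex.ofReal] using hall (Pi.single i 1)

theorem IsControllablePair.eq_zero_of_resonance {d : ℕ} {a : Matrix (Fin d) (Fin d) ℝ}
    {b : Fin d → ℝ} (h : IsControllablePair a b) {l : ℂ} (hl : l ∈ (cpx a).charpoly.roots)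
    {y : Fin d → ℂ} {c : ℂ} (hy : cpx a *ᵥ y + (fun i => b i * c) = l • y) : c = 0 := by
  rw [← charpoly_transpose, mem_roots_charpoly_iff_exists_eigenvector] at hl
  obtain ⟨ψ, hne, hψ⟩ := hl
  rw [mulVec_transpose] at hψ
  have hprod : (ψ ⬝ᵥ fun i => (b i : ℂ)) * c = 0 := by
    have hpair := congrArg (ψ ⬝ᵥ ·) hy
    simp only [dotProduct_add, dotProduct_mulVec, hψ, smul_dotProduct, dotProduct_smul,
      add_eq_left] at hpair
    rw [← hpair, dotProduct, dotProduct, Finset.sum_mul]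
    simp only [mul_assoc]
  exact (mul_eq_zero.1 hprod).resolve_left fun hb => hne (h.eq_zero_of_left_eigenvector hψ hb)

theorem mem_roots_charpoly_of_minpoly_dvd {m n : Type*} [Fintype m] [DecidableEq m] [Fintype n]
    [DecidableEq n] {S : Matrix m m ℝ} {a : Matrix n n ℝ} (hdvd : minpoly ℝ S ∣ a.charpoly) {l : ℂ}
    (hl : l ∈ (cpx S).charpoly.roots) : l ∈ (cpx a).charpoly.roots := by
  obtain ⟨φ, hφ, hSφ⟩ := mem_roots_charpoly_iff_exists_eigenvector.1 hl
  have heigen : Module.End.HasEigenvector (toLinAlgEquiv' (cpx S)) l φ :=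
    ⟨Module.End.mem_eigenspace_iff.2 hSφ, hφ⟩
  have hannihilates : Polynomial.aeval (cpx S) (cpx a).charpoly = 0 := by
    have hmap := Polynomial.map_aeval_eq_aeval_map (φ := Complex.ofRealHom)
      (ψ := Complex.ofRealHom.mapMatrix (m := m))
      (by ext r i j; simp [algebraMap_matrix_apply, apply_ite Complex.ofReal]) a.charpoly S
    rw [Polynomial.aeval_eq_zero_of_dvd_aeval_eq_zero hdvd (minpoly.aeval ℝ S), map_zero,
      ← charpoly_map] at hmap
    exact hmap.symm
  have heval := Module.End.aeval_apply_of_hasEigenvector (p := (cpx a).charpoly) heigen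
  rw [Polynomial.aeval_algHom_apply, hannihilates, map_zero, LinearMap.zero_apply] at heval
  exact (Polynomial.mem_roots (charpoly_monic _).ne_zero).2
    ((smul_eq_zero.1 heval.symm).resolve_right hφ)

theorem mulVec_blockDiagonal_add_inr {r p : ℕ} {d : Fin p → ℕ}
    (α : ∀ k, Matrix (Fin (d k)) (Fin (d k)) ℝ) (β : ∀ k, Fin (d k) → ℝ)
    (S₁ : Matrix (Fin r) (Fin r) ℝ) (S₂ : Matrix (Fin r) (Σ k, Fin (d k)) ℝ)
    (S₃ : Matrix (Fin r) (Fin p) ℝ) (y : Fin r ⊕ (Σ k, Fin (d k)) → ℂ) (e : Fin p → ℂ) (k : Fin p)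
    (a : Fin (d k)) :
    (cpx (fromBlocks S₁ S₂ 0 (blockDiagonal' α)) *ᵥ y +
        cpx (fromRows S₃ (of fun (a : Σ k, Fin (d k)) k => if a.1 = k then β a.1 a.2 else 0)) *ᵥ e)
          (Sum.inr ⟨k, a⟩) =
      (cpx (α k) *ᵥ fun a => y (Sum.inr ⟨k, a⟩)) a + β k a * e k := by
  rw [Pi.add_apply]
  congr 1
  · simp only [mulVec, dotProduct, map_apply, Fintype.sum_sum_type, fromBlocks_apply₂₁,
      fromBlocks_apply₂₂, Matrix.zero_apply, Complex.ofReal_zero, zero_mul, Finset.sum_const_zero,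
      zero_add, Fintype.sum_sigma]
    rw [Finset.sum_eq_single k (fun k' _ hk' => Finset.sum_eq_zero fun b _ => by
      rw [blockDiagonal'_apply_ne _ _ _ hk'.symm, Complex.ofReal_zero, zero_mul]) (by simp)]
    simp
  · simp [mulVec, dotProduct, apply_ite Complex.ofReal]

theorem IncorporatesInternalModel.eq_zero_of_resonance {q c p : ℕ}
    {S : Matrix (Fin q) (Fin q) ℝ} {G₁ : Matrix (Fin c) (Fin c) ℝ} {G₂ : Matrix (Fin c) (Fin p) ℝ}
    (h : IncorporatesInternalModel S G₁ G₂) {l : ℂ} (hl : l ∈ (cpx S).charpoly.roots)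
    {y : Fin c → ℂ} {e : Fin p → ℂ} (hy : cpx G₁ *ᵥ y + cpx G₂ *ᵥ e = l • y) : e = 0 := by
  obtain ⟨r, d, α, β, S₁, S₂, S₃, T, Tinv, -, hTinv, hG₁, hG₂, hk⟩ := h
  have hcancel (x : Fin r ⊕ (Σ k, Fin (d k)) → ℂ) : cpx Tinv *ᵥ (cpx T *ᵥ x) = x := by
    rw [mulVec_mulVec, ← cpx_mul, hTinv]
    simp
  have hcpxG₂ := (congrArg cpx hG₂).trans (cpx_mul T _)
  have hblocks := congrArg (cpx Tinv *ᵥ ·) hy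
  simp only [hG₁, hcpxG₂, cpx_mul, mulVec_add, mulVec_smul, ← mulVec_mulVec, hcancel] at hblocks
  ext k
  refine (hk k).1.eq_zero_of_resonance (mem_roots_charpoly_of_minpoly_dvd (hk k).2 hl)
    (y := fun a => (cpx Tinv *ᵥ y) (Sum.inr ⟨k, a⟩)) (funext fun a => ?_)
  exact (mulVec_blockDiagonal_add_inr α β S₁ S₂ S₃ _ e k a).symm.trans
    (congrFun hblocks (Sum.inr ⟨k, a⟩))

end InternalModel

/-! ## Nodes -/

section Regulator

variable {n p q : Type*} [Fintype n] [Fintype p] [Fintype q]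
  {A : Matrix n n ℝ} {B : Matrix n p ℝ} {C : Matrix p n ℝ}

theorem IsHurwitz.exists_norm_dotProduct_mulVec_le [DecidableEq n] (hA : IsHurwitz A)
    (C : Matrix p n ℝ) :
    ∃ b : ℝ, 0 ≤ b ∧ ∀ l : ℂ, 0 ≤ l.re → ∀ x v,
      ‖star v ⬝ᵥ cpx C *ᵥ x‖ ≤ b * ‖v‖ * ‖l • x - cpx A *ᵥ x‖ := by
  obtain ⟨k, hk, hresolvent⟩ := exists_mul_norm_le_norm_smul_sub_mulVec hA
  obtain ⟨g, hg, hCle⟩ := exists_norm_mulVec_le (cpx C)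
  refine ⟨Fintype.card p * (g / k), by positivity, fun l hl x v => ?_⟩
  have hstate : ‖x‖ ≤ ‖l • x - cpx A *ᵥ x‖ / k := by
    rw [le_div_iff₀' hk]
    refine le_trans ?_ (hresolvent l hl x)
    gcongr
    exact le_mul_of_one_le_left (norm_nonneg _) (by linarith [norm_nonneg l])
  calc ‖star v ⬝ᵥ cpx C *ᵥ x‖
      ≤ Fintype.card p * ‖v‖ * ‖cpx C *ᵥ x‖ := norm_star_dotProduct_le _ _
    _ ≤ Fintype.card p * ‖v‖ * (g * (‖l • x - cpx A *ᵥ x‖ / k)) := by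
      gcongr
      exact (hCle x).trans (by gcongr)
    _ = Fintype.card p * (g / k) * ‖v‖ * ‖l • x - cpx A *ᵥ x‖ := by ring

theorem IsPassive.exists_power_lower_bound [DecidableEq n] (h : IsPassive A B C)
    (hA : IsHurwitz A) (Y : Matrix n p ℂ) :
    ∃ b : ℝ, ∀ (ε : ℝ) (l : ℂ) (x : n → ℂ) (v : p → ℂ), 0 ≤ ε → 0 ≤ l.re →
      cpx A *ᵥ x + cpx B *ᵥ v + (ε : ℂ) • Y *ᵥ v = l • x →
        -(ε * b * ‖v‖ ^ 2) ≤ (star v ⬝ᵥ cpx C *ᵥ x).re := by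
  obtain ⟨k, hk, hresolvent⟩ := hA.exists_norm_dotProduct_mulVec_le C
  obtain ⟨y, -, hYle⟩ := exists_norm_mulVec_le Y
  refine ⟨k * y, fun ε l x v hε hl hx => ?_⟩
  have hroot : l ∉ (cpx A).charpoly.roots := fun hroot => (hA l hroot).not_ge hl
  set x₀ := (l • (1 : Matrix n n ℂ) - cpx A)⁻¹ *ᵥ (cpx B *ᵥ v) with hx₀
  replace hx₀ := (resolvent_mulVec_eq_iff hroot).1 hx₀.symm
  have hpassive : 0 ≤ (star v ⬝ᵥ cpx C *ᵥ x₀).re := h.re_nonneg hl (by rw [← hx₀]; abel)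
  have hremainder : l • (x - x₀) - cpx A *ᵥ (x - x₀) = (ε : ℂ) • Y *ᵥ v := by
    rw [mulVec_sub, smul_sub, ← hx, ← hx₀]
    abel
  have hdefect : ‖star v ⬝ᵥ cpx C *ᵥ (x - x₀)‖ ≤ ε * (k * y) * ‖v‖ ^ 2 := by
    refine (hresolvent l hl (x - x₀) v).trans ?_
    rw [hremainder, norm_smul, Complex.norm_real, Real.norm_of_nonneg hε]
    calc k * ‖v‖ * (ε * ‖Y *ᵥ v‖) ≤ k * ‖v‖ * (ε * (y * ‖v‖)) := by gcongr; exact hYle v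
      _ = ε * (k * y) * ‖v‖ ^ 2 := by ring
  have hsplit : (star v ⬝ᵥ cpx C *ᵥ x).re =
      (star v ⬝ᵥ cpx C *ᵥ x₀).re + (star v ⬝ᵥ cpx C *ᵥ (x - x₀)).re := by
    rw [← Complex.add_re, ← dotProduct_add, ← mulVec_add, add_sub_cancel]
  rw [hsplit]
  linarith [(abs_le.1 ((Complex.abs_re_le_norm _).trans hdefect)).1]

/-- `X` solves the regulator equations: the graph `ξ = X η` is invariant under
`ξ' = A ξ - R η`, `η' = S η`, and the output `C ξ` equals `Q η` on it. -/
structure IsRegulator (A : Matrix n n ℂ) (R : Matrix n q ℂ) (C : Matrix p n ℂ) (S : Matrix q q ℂ)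
    (Q : Matrix p q ℂ) (X : Matrix n q ℂ) : Prop where
  invariant : A * X - X * S = R
  output : C * X = Q

variable {R X : Matrix n q ℂ} {S : Matrix q q ℂ} {Q : Matrix p q ℂ}

theorem IsRegulator.exists_power_lower_bound [DecidableEq n]
    (hX : IsRegulator (cpx A) R (cpx C) S Q X) (h : IsPassive A B C) (hA : IsHurwitz A)
    {P : Matrix q q ℂ} (hP : IsLyapunovMatrix P S) {Bη : Matrix q p ℂ} (hBη : P * Bη = Qᴴ) :
    ∃ b : ℝ, ∀ (ε : ℝ) (l : ℂ) (ξ : n → ℂ) (η : q → ℂ) (v : p → ℂ), 0 < ε → 0 ≤ l.re →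
      cpx A *ᵥ ξ + cpx B *ᵥ v - R *ᵥ η = l • ξ → S *ᵥ η + (ε : ℂ) • Bη *ᵥ v = l • η →
        -(ε * b * ‖v‖ ^ 2) ≤ (star v ⬝ᵥ cpx C *ᵥ ξ).re := by
  obtain ⟨b, hb⟩ := h.exists_power_lower_bound hA (-(X * Bη))
  refine ⟨b, fun ε l ξ η v hε hl hξ hη => ?_⟩
  have htransverse := hb ε l (ξ - X *ᵥ η) v hε.le hl (by
    have hXη : l • X *ᵥ η = X *ᵥ (S *ᵥ η + (ε : ℂ) • Bη *ᵥ v) := by rw [hη, mulVec_smul]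
    rw [smul_sub, hXη, ← hξ, ← hX.invariant]
    simp only [neg_mulVec, mulVec_sub, sub_mulVec, mulVec_add, mulVec_smul, mulVec_mulVec, smul_neg]
    abel)
  have hexosystem : 0 ≤ (star v ⬝ᵥ Q *ᵥ η).re := by
    have hpower := hP.re_nonneg hBη hl (x := η) (u := (ε : ℂ) • v) (by rwa [mulVec_smul])
    rw [star_smul, smul_dotProduct, Complex.star_def, Complex.conj_ofReal, smul_eq_mul,
      Complex.re_ofReal_mul] at hpower
    exact nonneg_of_mul_nonneg_right hpower hε
  rw [mulVec_sub, dotProduct_sub, Complex.sub_re, mulVec_mulVec, hX.output] at htransverse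
  linarith

omit [Fintype p] in
theorem IsRegulator.eq_mulVec_of_eigenvector [DecidableEq n]
    (hX : IsRegulator (cpx A) R (cpx C) S Q X) (hA : IsHurwitz A) {l : ℂ} (hl : 0 ≤ l.re)
    {ξ : n → ℂ} {η : q → ℂ} (hξ : cpx A *ᵥ ξ - R *ᵥ η = l • ξ) (hη : S *ᵥ η = l • η) :
    ξ = X *ᵥ η := by
  have heigen : cpx A *ᵥ (ξ - X *ᵥ η) = l • (ξ - X *ᵥ η) := by
    rw [smul_sub, ← mulVec_smul, ← hη, ← hξ, ← hX.invariant]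
    simp only [mulVec_sub, sub_mulVec, mulVec_mulVec]
    abel
  by_contra hne
  exact (hA l (mem_roots_charpoly_iff_exists_eigenvector.2
    ⟨_, sub_ne_zero.2 hne, heigen⟩)).not_ge hl

end Regulator

namespace ControllerGains

variable {N M p q : ℕ} {sys : MultiAgentSystem N M p} (K : ControllerGains sys) (i : Fin N)

/-- Input matrix from the reference output `Q η i` to the state `(x i, ζ i)`, which the controller
subtracts from the measured output: `ξ' = Ahat ξ + Dhat v - Ghat Q η`. -/
def Ghat : Matrix (Fin (sys.n i) ⊕ Fin (K.c i)) (Fin p) ℝ :=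
  Matrix.fromRows 0 (K.G₂ i)

theorem cpx_Chat_mulVec (ξ : Fin (sys.n i) ⊕ Fin (K.c i) → ℂ) :
    cpx (K.Chat i) *ᵥ ξ = cpx (sys.C i) *ᵥ (ξ ∘ Sum.inl) := by
  ext a
  simp [Chat, mulVec, dotProduct]

theorem cpx_Ahat_mulVec (ξ : Fin (sys.n i) ⊕ Fin (K.c i) → ℂ) :
    cpx (K.Ahat i) *ᵥ ξ = Sum.elim
      (cpx (sys.A i + sys.B i * K.Kx i) *ᵥ (ξ ∘ Sum.inl) +
        cpx (sys.B i * K.Kζ i) *ᵥ (ξ ∘ Sum.inr))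
      (cpx (K.G₂ i) *ᵥ (cpx (sys.C i) *ᵥ (ξ ∘ Sum.inl)) + cpx (K.G₁ i) *ᵥ (ξ ∘ Sum.inr)) := by
  rw [Ahat, cpx, fromBlocks_map, fromBlocks_mulVec, ← cpx, ← cpx, ← cpx, ← cpx, cpx_mul (K.G₂ i),
    mulVec_mulVec]

theorem cpx_Dhat_mulVec (v : Fin p → ℂ) :
    cpx (K.Dhat i) *ᵥ v = Sum.elim (cpx (sys.D i) *ᵥ v) 0 := by
  ext a
  cases a <;> simp [Dhat, mulVec, dotProduct]

theorem cpx_Ghat_mulVec (r : Fin p → ℂ) :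
    cpx (K.Ghat i) *ᵥ r = Sum.elim (0 : Fin (sys.n i) → ℂ) (cpx (K.G₂ i) *ᵥ r) := by
  ext a
  cases a <;> simp [Ghat, mulVec, dotProduct]

theorem cpx_Ahat_mulVec_sub_cpx_Ghat_mulVec_inr (ξ : Fin (sys.n i) ⊕ Fin (K.c i) → ℂ)
    (r : Fin p → ℂ) :
    (cpx (K.Ahat i) *ᵥ ξ - cpx (K.Ghat i) *ᵥ r) ∘ Sum.inr =
      cpx (K.G₁ i) *ᵥ (ξ ∘ Sum.inr) + cpx (K.G₂ i) *ᵥ (cpx (K.Chat i) *ᵥ ξ - r) := by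
  rw [cpx_Ahat_mulVec, cpx_Ghat_mulVec, cpx_Chat_mulVec, mulVec_sub]
  ext a
  simp only [Function.comp_apply, Pi.sub_apply, Pi.add_apply, Sum.elim_inr]
  ring

-- The invariance equation is a Sylvester equation. On its solution the internal model is driven by
-- the regulation error at the eigenvalues of `S`, so the error vanishes on the eigenvectors of `S`.
theorem exists_isRegulator {S : Matrix (Fin q) (Fin q) ℝ}
    (hS : ⨆ l, Module.End.eigenspace (toLin' (cpx S)) l = ⊤)
    (hre : ∀ l ∈ (cpx S).charpoly.roots, l.re = 0) (hA : IsHurwitz (K.Ahat i))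
    (hIM : IncorporatesInternalModel S (K.G₁ i) (K.G₂ i)) (Q : Matrix (Fin p) (Fin q) ℝ) :
    ∃ X, IsRegulator (cpx (K.Ahat i)) (cpx (K.Ghat i) * cpx Q) (cpx (K.Chat i)) (cpx S)
      (cpx Q) X := by
  obtain ⟨X, hX⟩ := exists_sylvester_solution (A := cpx (K.Ahat i)) (B := cpx S)
    (fun l hlA hlS => (hA l hlA).ne (hre l hlS)) (cpx (K.Ghat i) * cpx Q)
  refine ⟨X, hX, ?_⟩
  have herror : toLin' (cpx (K.Chat i) * X - cpx Q) = 0 :=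
    eq_zero_of_forall_eigenvector_eq_zero hS _ fun l φ hφ hSφ => by
      rw [toLin'_apply] at hSφ ⊢
      have hgraph : cpx (K.Ahat i) *ᵥ (X *ᵥ φ) - cpx (K.Ghat i) *ᵥ (cpx Q *ᵥ φ) =
          l • X *ᵥ φ := by
        rw [← mulVec_smul, ← hSφ, mulVec_mulVec, mulVec_mulVec, ← hX, sub_mulVec, mulVec_mulVec,
          sub_sub_cancel]
      refine hIM.eq_zero_of_resonance (l := l) (y := (X *ᵥ φ) ∘ Sum.inr)
        (mem_roots_charpoly_iff_exists_eigenvector.2 ⟨φ, hφ, hSφ⟩) ?_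
      rw [sub_mulVec, ← mulVec_mulVec, ← cpx_Ahat_mulVec_sub_cpx_Ghat_mulVec_inr, hgraph]
      rfl
  exact sub_eq_zero.1 (toLin'.map_eq_zero_iff.1 herror)

end ControllerGains

/-! ## The network -/

namespace MultiAgentSystem

variable {N M p : ℕ} (sys : MultiAgentSystem N M p)

theorem sum_H (j : Fin M) : ∑ i, sys.H i j = 0 := by
  have hentry (i : Fin N) : sys.H i j =
      (if i = sys.pos j then 1 else 0) + (if i = sys.neg j then -1 else 0) := by
    simp only [H, of_apply]
    split_ifs with hpos hneg
    · exact absurd (hpos.symm.trans hneg) (sys.pos_ne_neg j)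
    all_goals simp
  simp [hentry, Finset.sum_add_distrib]

theorem abs_H_le_one (i : Fin N) (j : Fin M) : |sys.H i j| ≤ 1 := by
  simp only [H, of_apply]
  split_ifs <;> simp

/-- The input of edge `j`, over `ℂ`, when the nodes have the outputs `y i`. -/
noncomputable def edgeInput (j : Fin M) : (Fin N → Fin p → ℂ) →ₗ[ℂ] Fin p → ℂ :=
  ∑ i, (sys.H i j : ℂ) • LinearMap.proj i

/-- The neighboring input of node `i`, over `ℂ`, when the edges have the outputs `w j`. -/
noncomputable def neighboringInput (i : Fin N) : (Fin M → Fin p → ℂ) →ₗ[ℂ] Fin p → ℂ :=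
  -∑ j, (sys.H i j : ℂ) • LinearMap.proj j

theorem edgeInput_apply (j : Fin M) (y : Fin N → Fin p → ℂ) :
    sys.edgeInput j y = ∑ i, (sys.H i j : ℂ) • y i := by
  simp [edgeInput]

theorem neighboringInput_apply (i : Fin N) (w : Fin M → Fin p → ℂ) :
    sys.neighboringInput i w = -∑ j, (sys.H i j : ℂ) • w j := by
  simp [neighboringInput]

theorem sum_neighboringInput (w : Fin M → Fin p → ℂ) : ∑ i, sys.neighboringInput i w = 0 := by
  have hcolumn (j : Fin M) : ∑ i, (sys.H i j : ℂ) = 0 := by exact_mod_cast sys.sum_H j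
  simp only [neighboringInput_apply, Finset.sum_neg_distrib]
  rw [Finset.sum_comm]
  simp only [← Finset.sum_smul, hcolumn, zero_smul, Finset.sum_const_zero, neg_zero]

theorem norm_neighboringInput_le (i : Fin N) (w : Fin M → Fin p → ℂ) :
    ‖sys.neighboringInput i w‖ ≤ ∑ j, ‖w j‖ := by
  rw [neighboringInput_apply, norm_neg]
  refine (norm_sum_le _ _).trans (Finset.sum_le_sum fun j _ => ?_)
  rw [norm_smul, Complex.norm_real, Real.norm_eq_abs]
  exact mul_le_of_le_one_left (norm_nonneg _) (sys.abs_H_le_one i j)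

theorem sum_norm_neighboringInput_sq_le (w : Fin M → Fin p → ℂ) :
    ∑ i, ‖sys.neighboringInput i w‖ ^ 2 ≤ N * M * ∑ j, ‖w j‖ ^ 2 := by
  calc ∑ i, ‖sys.neighboringInput i w‖ ^ 2 ≤ ∑ _ : Fin N, (M : ℝ) * ∑ j, ‖w j‖ ^ 2 := by
        refine Finset.sum_le_sum fun i _ => ?_
        refine (pow_le_pow_left₀ (norm_nonneg _) (sys.norm_neighboringInput_le i w) 2).trans ?_
        simpa using sq_sum_le_card_mul_sum_sq (s := Finset.univ) (f := fun j => ‖w j‖)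
    _ = N * M * ∑ j, ‖w j‖ ^ 2 := by simp [mul_assoc]

theorem sum_re_star_edgeInput_dotProduct (y : Fin N → Fin p → ℂ) (w : Fin M → Fin p → ℂ) :
    ∑ j, (star (sys.edgeInput j y) ⬝ᵥ w j).re =
      -∑ i, (star (sys.neighboringInput i w) ⬝ᵥ y i).re := by
  simp only [edgeInput_apply, neighboringInput_apply, star_neg, star_sum, star_smul,
    sum_dotProduct, neg_dotProduct, smul_dotProduct, Complex.re_sum, Complex.neg_re,
    Finset.sum_neg_distrib, neg_neg, Complex.star_def, Complex.conj_ofReal, smul_eq_mul,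
    Complex.re_ofReal_mul]
  rw [Finset.sum_comm]
  refine Finset.sum_congr rfl fun i _ => Finset.sum_congr rfl fun j _ => ?_
  rw [star_dotProduct, Complex.star_def, Complex.conj_re, dotProduct_comm]

theorem edge_outputs_eq_zero_of_power_bounds {b c : ℝ} (hb : 0 ≤ b) (hbc : b * (N * M) < c)
    {y : Fin N → Fin p → ℂ} {w : Fin M → Fin p → ℂ}
    (hedge : ∀ j, c * ‖w j‖ ^ 2 ≤ (star (sys.edgeInput j y) ⬝ᵥ w j).re)
    (hnode : ∀ i, -(b * ‖sys.neighboringInput i w‖ ^ 2) ≤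
      (star (sys.neighboringInput i w) ⬝ᵥ y i).re) : w = 0 := by
  have hpower : c * ∑ j, ‖w j‖ ^ 2 ≤ b * (N * M) * ∑ j, ‖w j‖ ^ 2 := calc
    c * ∑ j, ‖w j‖ ^ 2 ≤ ∑ j, (star (sys.edgeInput j y) ⬝ᵥ w j).re := by
      rw [Finset.mul_sum]
      exact Finset.sum_le_sum fun j _ => hedge j
    _ = ∑ i, -(star (sys.neighboringInput i w) ⬝ᵥ y i).re := by
      rw [sum_re_star_edgeInput_dotProduct, Finset.sum_neg_distrib]
    _ ≤ b * ∑ i, ‖sys.neighboringInput i w‖ ^ 2 := by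
      rw [Finset.mul_sum]
      exact Finset.sum_le_sum fun i _ => neg_le.1 (hnode i)
    _ ≤ b * (N * M * ∑ j, ‖w j‖ ^ 2) := by gcongr; exact sys.sum_norm_neighboringInput_sq_le w
    _ = b * (N * M) * ∑ j, ‖w j‖ ^ 2 := by ring
  have hnonpos : ∑ j, ‖w j‖ ^ 2 ≤ 0 := by
    by_contra! hpos
    exact hpower.not_gt (mul_lt_mul_of_pos_right hbc hpos)
  funext j
  have hterm := Finset.single_le_sum (f := fun j => ‖w j‖ ^ 2) (fun j _ => by positivity)
    (Finset.mem_univ j)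
  exact norm_eq_zero.1 (pow_eq_zero_iff two_ne_zero |>.1
    (le_antisymm (hterm.trans hnonpos) (by positivity)))

variable {sys}

theorem IsConnected.finrank_ker_transpose (h : sys.IsConnected) :
    Module.finrank ℝ (LinearMap.ker sys.Hᵀ.mulVecLin) = 1 := by
  have hsum := LinearMap.finrank_range_add_finrank_ker sys.Hᵀ.mulVecLin
  rw [show Module.finrank ℝ (LinearMap.range sys.Hᵀ.mulVecLin) = sys.H.rank by
    rw [← rank_transpose, Matrix.rank], Module.finrank_fin_fun] at hsum
  have hrank : sys.H.rank + 1 = N := h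
  lia

theorem IsConnected.eq_of_transpose_mulVec_eq_zero (h : sys.IsConnected) {g : Fin N → ℝ}
    (hg : sys.Hᵀ *ᵥ g = 0) (i k : Fin N) : g i = g k := by
  let one : LinearMap.ker sys.Hᵀ.mulVecLin := ⟨1, by
    ext j
    simpa [vecMul, dotProduct] using sys.sum_H j⟩
  have hone : one ≠ 0 := fun hzero => one_ne_zero (congrFun (congrArg Subtype.val hzero) i)
  obtain ⟨c, hc⟩ := (finrank_eq_one_iff_of_nonzero' one hone).1 h.finrank_ker_transpose ⟨g, hg⟩
  have hconstant : c • (1 : Fin N → ℝ) = g := congrArg Subtype.val hc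
  simp [← hconstant]

theorem IsConnected.eq_of_edgeInput_eq_zero (h : sys.IsConnected) {y : Fin N → Fin p → ℂ}
    (hy : ∀ j, sys.edgeInput j y = 0) (i k : Fin N) : y i = y k := by
  have hpart (φ : ℂ →L[ℝ] ℝ) (a : Fin p) : φ (y i a) = φ (y k a) := by
    refine h.eq_of_transpose_mulVec_eq_zero (g := fun i => φ (y i a)) ?_ i k
    funext j
    have hcoordinate := congrArg φ (congrFun (hy j) a)
    rw [edgeInput_apply] at hcoordinate
    simpa [mulVec, dotProduct, ← Complex.real_smul] using hcoordinate
  ext a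
  exact Complex.ext (hpart Complex.reCLM a) (hpart Complex.imCLM a)

end MultiAgentSystem

/-! ## Modes of the closed loop -/

namespace ControllerGains

variable {N M p q : ℕ} {sys : MultiAgentSystem N M p} (K : ControllerGains sys)

/-- The complexified state space of the closed loop: the states `(x i, ζ i)`, `z j` and `η i`. -/
abbrev ModalState (q : ℕ) : Type :=
  (∀ i, Fin (sys.n i) ⊕ Fin (K.c i) → ℂ) × (∀ j, Fin (sys.ne j) → ℂ) × (Fin N → Fin q → ℂ)

/-- The node outputs `y` as a function of the complexified closed-loop state. -/
noncomputable def nodeOutput : K.ModalState q →ₗ[ℂ] Fin N → Fin p → ℂ :=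
  LinearMap.pi fun i => (cpx (K.Chat i)).mulVecLin ∘ₗ LinearMap.proj i ∘ₗ LinearMap.fst ℂ _ _

/-- The edge outputs `w` as a function of the complexified closed-loop state. -/
noncomputable def edgeOutput : K.ModalState q →ₗ[ℂ] Fin M → Fin p → ℂ :=
  LinearMap.pi fun j =>
    (cpx (sys.G j)).mulVecLin ∘ₗ LinearMap.proj j ∘ₗ LinearMap.fst ℂ _ _ ∘ₗ LinearMap.snd ℂ _ _

/-- The linear vector field of the closed loop on the complexified state space. -/
noncomputable def generator (S : Matrix (Fin q) (Fin q) ℝ) (Bη : Matrix (Fin q) (Fin p) ℝ)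
    (Q : Matrix (Fin p) (Fin q) ℝ) (ε : ℝ) : K.ModalState q →L[ℂ] K.ModalState q :=
  LinearMap.toContinuousLinearMap <|
    (LinearMap.pi fun i =>
      (cpx (K.Ahat i)).mulVecLin ∘ₗ LinearMap.proj i ∘ₗ LinearMap.fst ℂ _ _ +
        (cpx (K.Dhat i)).mulVecLin ∘ₗ sys.neighboringInput i ∘ₗ K.edgeOutput -
        (cpx (K.Ghat i) * cpx Q).mulVecLin ∘ₗ LinearMap.proj i ∘ₗ
          LinearMap.snd ℂ _ _ ∘ₗ LinearMap.snd ℂ _ _).prod <|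
    (LinearMap.pi fun j =>
      (cpx (sys.E j)).mulVecLin ∘ₗ LinearMap.proj j ∘ₗ
          LinearMap.fst ℂ _ _ ∘ₗ LinearMap.snd ℂ _ _ +
        (cpx (sys.F j)).mulVecLin ∘ₗ sys.edgeInput j ∘ₗ K.nodeOutput).prod <|
    LinearMap.pi fun i =>
      (cpx S).mulVecLin ∘ₗ LinearMap.proj i ∘ₗ LinearMap.snd ℂ _ _ ∘ₗ LinearMap.snd ℂ _ _ +
        (ε : ℂ) • (cpx Bη).mulVecLin ∘ₗ sys.neighboringInput i ∘ₗ K.edgeOutput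

theorem nodeOutput_apply (X : K.ModalState q) (i : Fin N) :
    K.nodeOutput X i = cpx (K.Chat i) *ᵥ X.1 i := rfl

theorem edgeOutput_apply (X : K.ModalState q) (j : Fin M) :
    K.edgeOutput X j = cpx (sys.G j) *ᵥ X.2.1 j := rfl

variable {S P : Matrix (Fin q) (Fin q) ℝ} {Bη : Matrix (Fin q) (Fin p) ℝ}
  {Q : Matrix (Fin p) (Fin q) ℝ} {ε : ℝ}

theorem generator_fst (X : K.ModalState q) (i : Fin N) : (K.generator S Bη Q ε X).1 i =
    cpx (K.Ahat i) *ᵥ X.1 i + cpx (K.Dhat i) *ᵥ sys.neighboringInput i (K.edgeOutput X) -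
      (cpx (K.Ghat i) * cpx Q) *ᵥ X.2.2 i := rfl

theorem generator_snd_fst (X : K.ModalState q) (j : Fin M) :
    (K.generator S Bη Q ε X).2.1 j =
      cpx (sys.E j) *ᵥ X.2.1 j + cpx (sys.F j) *ᵥ sys.edgeInput j (K.nodeOutput X) := rfl

theorem generator_snd_snd (X : K.ModalState q) (i : Fin N) :
    (K.generator S Bη Q ε X).2.2 i =
      cpx S *ᵥ X.2.2 i + (ε : ℂ) • cpx Bη *ᵥ sys.neighboringInput i (K.edgeOutput X) := rfl

variable {K}

theorem eigenvector_generator_iff {l : ℂ} {X : K.ModalState q} :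
    K.generator S Bη Q ε X = l • X ↔
      (∀ i, cpx (K.Ahat i) *ᵥ X.1 i +
        cpx (K.Dhat i) *ᵥ sys.neighboringInput i (K.edgeOutput X) -
          (cpx (K.Ghat i) * cpx Q) *ᵥ X.2.2 i = l • X.1 i) ∧
      (∀ j, cpx (sys.E j) *ᵥ X.2.1 j + cpx (sys.F j) *ᵥ sys.edgeInput j (K.nodeOutput X) =
        l • X.2.1 j) ∧
      ∀ i, cpx S *ᵥ X.2.2 i + (ε : ℂ) • cpx Bη *ᵥ sys.neighboringInput i (K.edgeOutput X) =
        l • X.2.2 i := by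
  simp only [Prod.ext_iff, funext_iff (α := Fin _)]
  rfl

theorem exists_gain_forall_unstable_mode_edgeOutput_eq_zero
    (hedges : ∀ j, IsStrictlyPositiveReal (sys.E j) (sys.F j) (sys.G j))
    (hreg : ∀ i, ∃ X, IsRegulator (cpx (K.Ahat i)) (cpx (K.Ghat i) * cpx Q) (cpx (K.Chat i))
      (cpx S) (cpx Q) X)
    (hnodes : ∀ i, IsHurwitz (K.Ahat i) ∧ IsPassive (K.Ahat i) (K.Dhat i) (K.Chat i))
    (hP : IsLyapunovMatrix (cpx P) (cpx S)) (hBη : cpx P * cpx Bη = (cpx Q)ᴴ) :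
    ∃ εstar : ℝ, 0 < εstar ∧ ∀ ε : ℝ, 0 < ε → ε < εstar → ∀ l : ℂ, 0 ≤ l.re →
      ∀ X : K.ModalState q, K.generator S Bη Q ε X = l • X → K.edgeOutput X = 0 := by
  choose c hc hedge using fun j => (hedges j).exists_output_strict
  choose b hnode using fun i =>
    (hreg i).choose_spec.exists_power_lower_bound (hnodes i).2 (hnodes i).1 hP hBη
  obtain ⟨c₀, hc₀, hcle⟩ := (eventually_mem_nhdsWithin.and
    (eventually_all.2 fun j => Ioc_mem_nhdsGT (hc j)) :
      ∀ᶠ c₀ in 𝓝[>] (0 : ℝ), c₀ ∈ Ioi 0 ∧ ∀ j, c₀ ∈ Ioc 0 (c j)).exists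
  obtain ⟨b₀, hb₀, hble⟩ := ((eventually_ge_atTop 0).and
    (eventually_all.2 fun i => eventually_ge_atTop (b i))).exists
  rw [mem_Ioi] at hc₀
  refine ⟨c₀ / (b₀ * (N * M) + 1), by positivity, fun ε hε hεstar l hl X hX => ?_⟩
  rw [lt_div_iff₀ (by positivity)] at hεstar
  obtain ⟨hξ, hz, hη⟩ := eigenvector_generator_iff.1 hX
  refine sys.edge_outputs_eq_zero_of_power_bounds (b := ε * b₀) (c := c₀) (by positivity)
    (by linarith) (y := K.nodeOutput X) (fun j => ?_) fun i => ?_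
  · have htransfer := transferFunction_mulVec_eq (G := sys.G j)
      (fun hroot => ((hedges j).isHurwitz l hroot).not_ge hl)
      (show _ - _ = cpx (sys.F j) *ᵥ sys.edgeInput j (K.nodeOutput X) by rw [← hz j]; abel)
    refine le_trans ?_ ((hedge j l hl _).trans_eq (by rw [htransfer, edgeOutput_apply]))
    rw [htransfer, edgeOutput_apply]
    exact mul_le_mul_of_nonneg_right (hcle j).2 (by positivity)
  · refine le_trans (neg_le_neg ?_) (hnode i ε l _ _ _ hε hl (hξ i) (hη i))
    gcongr
    exact hble i

variable (S Q) in
/-- A mode `X` at `l` of the closed loop that is driven by its exosystem states: these are modes of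
`S`, they determine `X`, and they generate the node outputs, which all coincide. -/
structure IsSynchronousMode (l : ℂ) (X : K.ModalState q) : Prop where
  exosystem : ∀ i, cpx S *ᵥ X.2.2 i = l • X.2.2 i
  output : ∀ i, K.nodeOutput X i = cpx Q *ᵥ X.2.2 i
  consensus : ∀ i k, K.nodeOutput X i = K.nodeOutput X k
  eq_zero : X.2.2 = 0 → X = 0

theorem isSynchronousMode_of_edgeOutput_eq_zero
    (hedges : ∀ j, IsStrictlyPositiveReal (sys.E j) (sys.F j) (sys.G j))
    (hconnected : sys.IsConnected)
    (hreg : ∀ i, ∃ X, IsRegulator (cpx (K.Ahat i)) (cpx (K.Ghat i) * cpx Q) (cpx (K.Chat i))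
      (cpx S) (cpx Q) X)
    (hnodes : ∀ i, IsHurwitz (K.Ahat i)) {l : ℂ} (hl : 0 ≤ l.re) {X : K.ModalState q}
    (hX : K.generator S Bη Q ε X = l • X) (hw : K.edgeOutput X = 0) :
    IsSynchronousMode S Q l X := by
  obtain ⟨hξ, hz, hη⟩ := eigenvector_generator_iff.1 hX
  simp only [hw, map_zero, mulVec_zero, add_zero, smul_zero] at hξ hη
  choose R hR using hreg
  have hgraph (i : Fin N) : X.1 i = R i *ᵥ X.2.2 i :=
    (hR i).eq_mulVec_of_eigenvector (hnodes i) hl (hξ i) (hη i)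
  have hroot (j : Fin M) : l ∉ (cpx (sys.E j)).charpoly.roots := fun hroot =>
    ((hedges j).isHurwitz l hroot).not_ge hl
  have hs (j : Fin M) : sys.edgeInput j (K.nodeOutput X) = 0 := by
    refine (hedges j).eq_zero_of_re_nonpos hl ?_
    rw [transferFunction_mulVec_eq (hroot j) (z := X.2.1 j) (by rw [← hz j]; abel),
      ← edgeOutput_apply, hw, Pi.zero_apply, dotProduct_zero, Complex.zero_re]
  refine ⟨hη, fun i => ?_, hconnected.eq_of_edgeInput_eq_zero hs, fun hzero => ?_⟩
  · rw [nodeOutput_apply, hgraph, mulVec_mulVec, (hR i).output]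
  · refine Prod.ext (funext fun i => ?_) (Prod.ext (funext fun j => ?_) hzero)
    · rw [hgraph, hzero, Pi.zero_apply, mulVec_zero]
      rfl
    · by_contra hne
      refine hroot j (mem_roots_charpoly_iff_exists_eigenvector.2 ⟨X.2.1 j, hne, ?_⟩)
      rw [← hz j, hs j, mulVec_zero, add_zero]

theorem IsSynchronousMode.exosystem_eq_zero_of_jordan_chain
    (hP : IsLyapunovMatrix (cpx P) (cpx S)) (hBη : cpx P * cpx Bη = (cpx Q)ᴴ) {l : ℂ}
    (hl : l.re = 0) {X Y : K.ModalState q} (hY : IsSynchronousMode S Q l Y)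
    (hX : K.generator S Bη Q ε X = l • X + Y) : Y.2.2 = 0 := by
  have henergy (i : Fin N) : star (Y.2.2 i) ⬝ᵥ cpx P *ᵥ Y.2.2 i =
      ε * (star (K.nodeOutput Y i) ⬝ᵥ sys.neighboringInput i (K.edgeOutput X)) := by
    have hYi : Y.2.2 i = (cpx S *ᵥ X.2.2 i - l • X.2.2 i) +
        (ε : ℂ) • cpx Bη *ᵥ sys.neighboringInput i (K.edgeOutput X) := by
      rw [sub_add_eq_add_sub, ← generator_snd_snd K (S := S) (Q := Q), hX]
      exact (add_sub_cancel_left _ _).symm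
    calc star (Y.2.2 i) ⬝ᵥ cpx P *ᵥ Y.2.2 i
        = star (Y.2.2 i) ⬝ᵥ cpx P *ᵥ ((cpx S *ᵥ X.2.2 i - l • X.2.2 i) +
            (ε : ℂ) • cpx Bη *ᵥ sys.neighboringInput i (K.edgeOutput X)) := by rw [← hYi]
      _ = ε * (star (K.nodeOutput Y i) ⬝ᵥ sys.neighboringInput i (K.edgeOutput X)) := by
        rw [mulVec_add, dotProduct_add, mulVec_smul, dotProduct_smul, hY.output, smul_eq_mul,
          hP.star_dotProduct_eq_zero_of_eigenvector hl (hY.exosystem i), zero_add,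
          star_dotProduct_mulVec_mulVec_of_mul_eq_conjTranspose hBη]
  have hsum : ∑ i, star (Y.2.2 i) ⬝ᵥ cpx P *ᵥ Y.2.2 i = 0 := by
    rcases isEmpty_or_nonempty (Fin N) with _ | ⟨⟨k⟩⟩
    · exact Finset.sum_of_isEmpty _
    · simp only [henergy, fun i => hY.consensus i k]
      rw [← Finset.mul_sum, ← dotProduct_sum, sys.sum_neighboringInput, dotProduct_zero, mul_zero]
  have hnonneg (i : Fin N) := hP.posDef.posSemidef.dotProduct_mulVec_nonneg (Y.2.2 i)
  funext i
  by_contra hne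
  exact (hP.posDef.dotProduct_mulVec_pos hne).ne'
    ((Finset.sum_eq_zero_iff_of_nonneg fun i _ => hnonneg i).1 hsum i (Finset.mem_univ i))

theorem IsSynchronousMode.eq_zero_of_jordan_chain
    (hre : ∀ l ∈ (cpx S).charpoly.roots, l.re = 0) (hP : IsLyapunovMatrix (cpx P) (cpx S))
    (hBη : cpx P * cpx Bη = (cpx Q)ᴴ) {l : ℂ} {X Y : K.ModalState q}
    (hY : IsSynchronousMode S Q l Y) (hX : K.generator S Bη Q ε X = l • X + Y) : Y = 0 := by
  refine hY.eq_zero ?_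
  by_contra hne
  obtain ⟨i, hi⟩ := Function.ne_iff.1 hne
  have hl : l.re = 0 :=
    hre l (mem_roots_charpoly_iff_exists_eigenvector.2 ⟨_, hi, hY.exosystem i⟩)
  exact hne (hY.exosystem_eq_zero_of_jordan_chain hP hBη hl hX)

theorem exists_gain_forall_unstable_mode_isSynchronousMode
    (hedges : ∀ j, IsStrictlyPositiveReal (sys.E j) (sys.F j) (sys.G j))
    (hconnected : sys.IsConnected)
    (hIM : ∀ i, IncorporatesInternalModel S (K.G₁ i) (K.G₂ i))
    (hnodes : ∀ i, IsHurwitz (K.Ahat i) ∧ IsPassive (K.Ahat i) (K.Dhat i) (K.Chat i))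
    (hre : ∀ l ∈ (cpx S).charpoly.roots, l.re = 0) (hP : IsLyapunovMatrix (cpx P) (cpx S))
    (hBη : cpx P * cpx Bη = (cpx Q)ᴴ) :
    ∃ εstar : ℝ, 0 < εstar ∧ ∀ ε : ℝ, 0 < ε → ε < εstar → ∀ l : ℂ, 0 ≤ l.re →
      ∀ X : K.ModalState q, K.generator S Bη Q ε X = l • X → IsSynchronousMode S Q l X := by
  have hreg (i : Fin N) := K.exists_isRegulator i (hP.iSup_eigenspace_eq_top hre) hre
    (hnodes i).1 (hIM i) Q
  obtain ⟨εstar, hpos, hgain⟩ :=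
    exists_gain_forall_unstable_mode_edgeOutput_eq_zero hedges hreg hnodes hP hBη
  exact ⟨εstar, hpos, fun ε hε hεstar l hl X hX => isSynchronousMode_of_edgeOutput_eq_zero hedges
    hconnected hreg (fun i => (hnodes i).1) hl hX (hgain ε hε hεstar l hl X hX)⟩

/-- The deviation, over `ℂ`, of the output of node `i` from the output of the averaged
exosystem. -/
noncomputable def syncError (K : ControllerGains sys) (Q : Matrix (Fin p) (Fin q) ℝ) (i : Fin N) :
    K.ModalState q →ₗ[ℂ] Fin p → ℂ :=
  LinearMap.proj i ∘ₗ K.nodeOutput - (cpx Q).mulVecLin ∘ₗ ((N : ℂ)⁻¹ •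
    ∑ k, LinearMap.proj k ∘ₗ LinearMap.snd ℂ _ _ ∘ₗ LinearMap.snd ℂ _ _)

theorem syncError_apply (i : Fin N) (X : K.ModalState q) :
    K.syncError Q i X = K.nodeOutput X i - cpx Q *ᵥ ((N : ℂ)⁻¹ • ∑ k, X.2.2 k) := by
  simp [syncError, mulVec_smul, mulVec_sum]

theorem IsSynchronousMode.syncError_eq_zero {l : ℂ} {X : K.ModalState q}
    (hX : IsSynchronousMode S Q l X) (i : Fin N) : K.syncError Q i X = 0 := by
  have hN : (N : ℂ) ≠ 0 := by exact_mod_cast i.pos.ne'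
  rw [syncError_apply, mulVec_smul, mulVec_sum]
  simp only [← hX.output, fun k => hX.consensus k i]
  rw [Finset.sum_const, Finset.card_univ, Fintype.card_fin, ← Nat.cast_smul_eq_nsmul ℂ, smul_smul,
    inv_mul_cancel₀ hN, one_smul, sub_self]

theorem tendsto_syncError_exp_smul (hre : ∀ l ∈ (cpx S).charpoly.roots, l.re = 0)
    (hP : IsLyapunovMatrix (cpx P) (cpx S)) (hBη : cpx P * cpx Bη = (cpx Q)ᴴ)
    (hmodes : ∀ l : ℂ, 0 ≤ l.re → ∀ X : K.ModalState q, K.generator S Bη Q ε X = l • X →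
      IsSynchronousMode S Q l X) (i : Fin N) (X : K.ModalState q) :
    Tendsto (fun t : ℝ => K.syncError Q i (NormedSpace.exp (t • K.generator S Bη Q ε) X)) atTop
      (𝓝 0) :=
  tendsto_apply_exp_smul_of_unstable_modes (K.generator S Bη Q ε)
    (LinearMap.toContinuousLinearMap (K.syncError Q i))
    (fun l hl X hX => (hmodes l hl X hX).syncError_eq_zero i)
    (fun l hl _ Y hY hX => (hmodes l hl Y hY).eq_zero_of_jordan_chain hre hP hBη hX) X

end ControllerGains

/-! ## Trajectories of the closed loop -/

section Trajectories

variable {N M p q : ℕ} {sys : MultiAgentSystem N M p} {K : ControllerGains sys}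
  {S P : Matrix (Fin q) (Fin q) ℝ} {Bη : Matrix (Fin q) (Fin p) ℝ}
  {Q : Matrix (Fin p) (Fin q) ℝ} {ε : ℝ}

theorem ControllerGains.generator_fst_inl (X : K.ModalState q) (i : Fin N) :
    (K.generator S Bη Q ε X).1 i ∘ Sum.inl = cpx (sys.A i) *ᵥ (X.1 i ∘ Sum.inl) +
      cpx (sys.B i) *ᵥ (cpx (K.Kx i) *ᵥ (X.1 i ∘ Sum.inl) +
        cpx (K.Kζ i) *ᵥ (X.1 i ∘ Sum.inr)) +
      cpx (sys.D i) *ᵥ sys.neighboringInput i (K.edgeOutput X) := by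
  have hAdd : cpx (sys.A i + sys.B i * K.Kx i) = cpx (sys.A i) + cpx (sys.B i) * cpx (K.Kx i) := by
    rw [← cpx_mul]
    exact Matrix.map_add _ Complex.ofReal_add _ _
  rw [K.generator_fst, ← mulVec_mulVec, cpx_Ahat_mulVec, cpx_Dhat_mulVec, cpx_Ghat_mulVec]
  ext a
  simp [hAdd, cpx_mul, add_mulVec, mulVec_add, add_assoc]

theorem ControllerGains.generator_fst_inr (X : K.ModalState q) (i : Fin N) :
    (K.generator S Bη Q ε X).1 i ∘ Sum.inr = cpx (K.G₁ i) *ᵥ (X.1 i ∘ Sum.inr) +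
      cpx (K.G₂ i) *ᵥ (K.nodeOutput X i - cpx Q *ᵥ X.2.2 i) := by
  rw [K.generator_fst, K.nodeOutput_apply, ← K.cpx_Ahat_mulVec_sub_cpx_Ghat_mulVec_inr,
    ← mulVec_mulVec, cpx_Dhat_mulVec]
  ext a
  simp

/-- The signals of a closed loop as a curve in the complexified state space. -/
noncomputable def Signals.modalState (σ : Signals K q) (t : ℝ) : K.ModalState q :=
  (fun i => Sum.elim (fun a => (σ.x i t a : ℂ)) fun a => (σ.ζ i t a : ℂ),
    fun j a => (σ.z j t a : ℂ), fun i a => (σ.η i t a : ℂ))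

namespace IsClosedLoopSolution

variable {σ : Signals K q} (hσ : IsClosedLoopSolution K S Bη Q ε σ) {t : ℝ} (ht : 0 ≤ t)

include hσ ht

theorem nodeOutput_modalState (i : Fin N) :
    K.nodeOutput (σ.modalState t) i = fun a => (σ.y i t a : ℂ) := by
  rw [K.nodeOutput_apply, K.cpx_Chat_mulVec, hσ.node_output i t ht]
  exact cpx_mulVec_ofReal _ _

theorem edgeOutput_modalState (j : Fin M) :
    K.edgeOutput (σ.modalState t) j = fun a => (σ.w j t a : ℂ) := by
  rw [K.edgeOutput_apply, hσ.edge_output j t ht]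
  exact cpx_mulVec_ofReal _ _

theorem neighboringInput_modalState (i : Fin N) :
    sys.neighboringInput i (K.edgeOutput (σ.modalState t)) = fun a => (σ.v i t a : ℂ) := by
  ext a
  simp [sys.neighboringInput_apply, hσ.edgeOutput_modalState ht, hσ.neighboring_input i t ht]

theorem edgeInput_modalState (j : Fin M) :
    sys.edgeInput j (K.nodeOutput (σ.modalState t)) = fun a => (σ.s j t a : ℂ) := by
  ext a
  simp [sys.edgeInput_apply, hσ.nodeOutput_modalState ht, hσ.edge_input j t ht]

theorem hasDerivWithinAt_modalState :
    HasDerivWithinAt σ.modalState (K.generator S Bη Q ε (σ.modalState t)) (Ici 0) t := by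
  have hcoe {n : ℕ} {x : ℝ → Fin n → ℝ} {x' : Fin n → ℝ} {w : ℂ} {a : Fin n}
      (hx : HasDerivWithinAt x x' (Ici 0) t) (hw : w = x' a) :
      HasDerivWithinAt (fun t => (x t a : ℂ)) w (Ici 0) t :=
    hw ▸ (hasDerivWithinAt_pi.1 hx a).ofReal_comp
  generalize hX' : K.generator S Bη Q ε (σ.modalState t) = X'
  refine HasDerivWithinAt.prodMk ?_ (HasDerivWithinAt.prodMk ?_ ?_) <;>
    refine hasDerivWithinAt_pi.2 fun i => hasDerivWithinAt_pi.2 ?_ <;> subst hX'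
  · rintro (a | a)
    · refine hcoe (hσ.node_state i t ht) ((congrFun (K.generator_fst_inl _ i) a).trans ?_)
      rw [hσ.neighboringInput_modalState ht, hσ.control_law i t ht]
      simp [Signals.modalState, Function.comp_def, mulVec_add, cpx_mulVec_ofReal]
    · refine hcoe (hσ.controller_state i t ht) ((congrFun (K.generator_fst_inr _ i) a).trans ?_)
      rw [hσ.nodeOutput_modalState ht]
      simp [Signals.modalState, mulVec_sub, Function.comp_def, cpx_mulVec_ofReal]
  · refine fun a => hcoe (hσ.edge_state i t ht) ?_
    rw [K.generator_snd_fst, hσ.edgeInput_modalState ht]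
    simp [Signals.modalState, cpx_mulVec_ofReal]
  · refine fun a => hcoe (hσ.exosystem i t ht) ?_
    rw [K.generator_snd_snd, hσ.neighboringInput_modalState ht]
    simp [Signals.modalState, cpx_mulVec_ofReal]

theorem sum_neighboring_input_eq_zero : ∑ i, σ.v i t = 0 := by
  have hsum := sys.sum_neighboringInput (K.edgeOutput (σ.modalState t))
  simp only [hσ.neighboringInput_modalState ht] at hsum
  ext a
  simpa [← Complex.ofReal_sum] using congrFun hsum a

theorem average_exosystem_eq : (N : ℝ)⁻¹ • ∑ k, σ.η k t =
    NormedSpace.exp (t • S) *ᵥ ((N : ℝ)⁻¹ • ∑ k, σ.η k 0) := by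
  refine eq_exp_smul_mulVec (X := fun t => (N : ℝ)⁻¹ • ∑ k, σ.η k t) (fun t ht => ?_) ht
  refine ((HasDerivWithinAt.fun_sum fun k (_ : k ∈ Finset.univ) =>
    hσ.exosystem k t ht).const_smul (N : ℝ)⁻¹).congr_deriv ?_
  rw [Finset.sum_add_distrib, ← Finset.smul_sum, ← mulVec_sum, ← mulVec_sum,
    hσ.sum_neighboring_input_eq_zero ht, mulVec_zero, smul_zero, add_zero, mulVec_smul]

theorem syncError_modalState (i : Fin N) :
    K.syncError Q i (σ.modalState t) = fun a => ((σ.y i t -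
      Q *ᵥ (NormedSpace.exp (t • S) *ᵥ ((N : ℝ)⁻¹ • ∑ k, σ.η k 0))) a : ℂ) := by
  have haverage : (N : ℂ)⁻¹ • ∑ k, (σ.modalState t).2.2 k =
      fun a => (((N : ℝ)⁻¹ • ∑ k, σ.η k t) a : ℂ) := by
    ext a
    simp [Signals.modalState]
  rw [ControllerGains.syncError_apply, hσ.nodeOutput_modalState ht, haverage,
    hσ.average_exosystem_eq ht, cpx_mulVec_ofReal]
  ext a
  simp

omit ht in
theorem tendsto_output_sub_average (hre : ∀ l ∈ (cpx S).charpoly.roots, l.re = 0)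
    (hP : IsLyapunovMatrix (cpx P) (cpx S)) (hBη : cpx P * cpx Bη = (cpx Q)ᴴ)
    (hmodes : ∀ l : ℂ, 0 ≤ l.re → ∀ X : K.ModalState q, K.generator S Bη Q ε X = l • X →
      ControllerGains.IsSynchronousMode S Q l X) (i : Fin N) :
    Tendsto (fun t => σ.y i t -
      Q *ᵥ (NormedSpace.exp (t • S) *ᵥ ((N : ℝ)⁻¹ • ∑ k, σ.η k 0))) atTop (𝓝 0) := by
  have herror := ControllerGains.tendsto_syncError_exp_smul hre hP hBη hmodes i (σ.modalState 0)
  refine tendsto_pi_nhds.2 fun a => ?_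
  refine ((Complex.continuous_re.tendsto 0).comp (tendsto_pi_nhds.1 herror a)).congr' ?_
  filter_upwards [eventually_ge_atTop 0] with t ht
  rw [Function.comp_apply,
    ← eq_exp_smul_apply (fun s hs => hσ.hasDerivWithinAt_modalState hs) ht,
    hσ.syncError_modalState ht, Complex.ofReal_re]

end IsClosedLoopSolution

/-- The signals of the real part of a curve in the complexified state space. -/
noncomputable def realSignals (X : ℝ → K.ModalState q) : Signals K q where
  x i t a := ((X t).1 i (Sum.inl a)).re
  u i t := K.Kx i *ᵥ (fun a => ((X t).1 i (Sum.inl a)).re) +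
    K.Kζ i *ᵥ fun a => ((X t).1 i (Sum.inr a)).re
  v i t a := (sys.neighboringInput i (K.edgeOutput (X t)) a).re
  y i t a := (K.nodeOutput (X t) i a).re
  z j t a := ((X t).2.1 j a).re
  s j t a := (sys.edgeInput j (K.nodeOutput (X t)) a).re
  w j t a := (K.edgeOutput (X t) j a).re
  η i t a := ((X t).2.2 i a).re
  ζ i t a := ((X t).1 i (Sum.inr a)).re

theorem re_cpx_mulVec {m n : Type*} [Fintype n] (A : Matrix m n ℝ) (x : n → ℂ) (i : m) :
    ((cpx A *ᵥ x) i).re = (A *ᵥ fun k => (x k).re) i :=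
  congrFun (map_cpx_mulVec Complex.reCLM A x) i

theorem hasDerivAt_re_comp {m n : Type*} [Finite m] [Finite n] {x : ℝ → m → ℂ} {x' : m → ℂ}
    {t : ℝ} (hx : HasDerivAt x x' t) (f : n → m) :
    HasDerivAt (fun t a => (x t (f a)).re) (fun a => (x' (f a)).re) t := by
  cases nonempty_fintype m
  cases nonempty_fintype n
  exact hasDerivAt_pi.2 fun a =>
    Complex.reCLM.hasFDerivAt.comp_hasDerivAt t (hasDerivAt_pi.1 hx (f a))

theorem isClosedLoopSolution_realSignals {X : ℝ → K.ModalState q}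
    (hX : ∀ t, HasDerivAt X (K.generator S Bη Q ε (X t)) t) :
    IsClosedLoopSolution K S Bη Q ε (realSignals X) where
  node_state i t _ := by
    refine ((hasDerivAt_re_comp (hasDerivAt_pi.1 (hX t).fst i) Sum.inl).congr_deriv
      (funext fun a => (congrArg Complex.re (congrFun (K.generator_fst_inl _ i) a)).trans
        ?_)).hasDerivWithinAt
    simp only [Pi.add_apply, Complex.add_re, re_cpx_mulVec]
    rfl
  node_output i t _ := by
    funext a
    simp only [realSignals, K.nodeOutput_apply, K.cpx_Chat_mulVec, re_cpx_mulVec]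
    rfl
  edge_state j t _ := by
    refine ((hasDerivAt_re_comp (hasDerivAt_pi.1 (hX t).snd.fst j) id).congr_deriv
      (funext fun a => ?_)).hasDerivWithinAt
    simp only [K.generator_snd_fst, Pi.add_apply, Complex.add_re, re_cpx_mulVec]
    rfl
  edge_output j t _ := funext fun a => re_cpx_mulVec _ _ a
  neighboring_input i t _ := by
    funext a
    simp [realSignals, sys.neighboringInput_apply]
  edge_input j t _ := by
    funext a
    simp [realSignals, sys.edgeInput_apply]
  exosystem i t _ := by
    refine ((hasDerivAt_re_comp (hasDerivAt_pi.1 (hX t).snd.snd i) id).congr_deriv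
      (funext fun a => ?_)).hasDerivWithinAt
    simp only [K.generator_snd_snd, Pi.add_apply, Pi.smul_apply, Complex.add_re, re_cpx_mulVec,
      smul_eq_mul, Complex.re_ofReal_mul]
    rfl
  controller_state i t _ := by
    refine ((hasDerivAt_re_comp (hasDerivAt_pi.1 (hX t).fst i) Sum.inr).congr_deriv
      (funext fun a => (congrArg Complex.re (congrFun (K.generator_fst_inr _ i) a)).trans
        ?_)).hasDerivWithinAt
    simp only [Pi.add_apply, Pi.sub_apply, Complex.add_re, Complex.sub_re, re_cpx_mulVec]
    rfl
  control_law _ _ _ := rfl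

variable (K S Bη Q ε) in
theorem exists_isClosedLoopSolution_of_exosystem_eq (η₀ : Fin q → ℝ) :
    ∃ σ : Signals K q, IsClosedLoopSolution K S Bη Q ε σ ∧ ∀ i, σ.η i 0 = η₀ := by
  set X₀ : K.ModalState q := (0, 0, fun _ a => (η₀ a : ℂ))
  refine ⟨realSignals fun t => NormedSpace.exp (t • K.generator S Bη Q ε) X₀,
    isClosedLoopSolution_realSignals fun t => hasDerivAt_exp_smul_apply _ X₀ t, fun i => ?_⟩
  simp only [realSignals, exp_zero_smul_apply]
  rfl

end Trajectories

/-! ## Persistence of the exosystem -/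

section Persistence

variable {m n : Type*} [Fintype n] [DecidableEq n]

theorem eq_zero_of_tendsto_realMode {l : ℂ} (hl : l.re = 0) {ξ : m → ℂ}
    (hξ : ∀ φ : ℂ →L[ℝ] ℝ, Tendsto (realMode φ l ξ) atTop (𝓝 0)) : ξ = 0 := by
  funext a
  have hcoord (φ : ℂ →L[ℝ] ℝ) := (Complex.continuous_ofReal.tendsto 0).comp
    (tendsto_pi_nhds.1 (hξ φ) a)
  have hmode : Tendsto (fun t : ℝ => Complex.exp (l * t) * ξ a) atTop (𝓝 0) := by
    have hsum := (hcoord Complex.reCLM).add ((hcoord Complex.imCLM).mul_const Complex.I)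
    rw [Complex.ofReal_zero, zero_mul, add_zero] at hsum
    exact hsum.congr fun t => Complex.re_add_im _
  have hnorm := hmode.norm
  simp only [norm_mul, Complex.norm_exp, Complex.mul_re, hl, Complex.ofReal_im, mul_zero,
    zero_mul, sub_zero, Real.exp_zero, one_mul, norm_zero] at hnorm
  exact norm_eq_zero.1 (tendsto_nhds_unique tendsto_const_nhds hnorm)

theorem realMode_eq_exp_smul_mulVec {S : Matrix n n ℝ} {l : ℂ} {ξ : n → ℂ}
    (hξ : cpx S *ᵥ ξ = l • ξ) (φ : ℂ →L[ℝ] ℝ) {t : ℝ} (ht : 0 ≤ t) :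
    realMode φ l ξ t = NormedSpace.exp (t • S) *ᵥ realMode φ l ξ 0 := by
  refine eq_exp_smul_mulVec (fun s _ => ?_) ht
  rw [mulVec_realMode, hξ]
  exact (hasDerivAt_realMode φ l ξ s).hasDerivWithinAt

theorem exists_not_tendsto_mulVec_exp_smul {S : Matrix n n ℝ} {Q : Matrix m n ℝ}
    (hS : ⨆ l, Module.End.eigenspace (toLin' (cpx S)) l = ⊤)
    (hre : ∀ l ∈ (cpx S).charpoly.roots, l.re = 0) (hQ : Q ≠ 0) :
    ∃ η₀ : n → ℝ, ¬ Tendsto (fun t : ℝ => Q *ᵥ (NormedSpace.exp (t • S) *ᵥ η₀)) atTop (𝓝 0) := by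
  by_contra! hdecay
  have hzero : toLin' (cpx Q) = 0 := eq_zero_of_forall_eigenvector_eq_zero hS _ fun l ξ hξ hSξ => by
    rw [toLin'_apply] at hSξ ⊢
    refine eq_zero_of_tendsto_realMode
      (hre l (mem_roots_charpoly_iff_exists_eigenvector.2 ⟨ξ, hξ, hSξ⟩)) fun φ => ?_
    refine (hdecay (realMode φ l ξ 0)).congr' ?_
    filter_upwards [eventually_ge_atTop 0] with t ht
    rw [← realMode_eq_exp_smul_mulVec hSξ φ ht, mulVec_realMode]
  refine hQ (map_injective Complex.ofReal_injective ?_)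
  exact (toLin'.map_eq_zero_iff.1 hzero).trans (Matrix.map_zero _ Complex.ofReal_zero).symm

end Persistence

theorem exists_isClosedLoopSolution_forall_not_tendsto {N M p q : ℕ}
    {sys : MultiAgentSystem N M p} {K : ControllerGains sys} {S : Matrix (Fin q) (Fin q) ℝ}
    {Bη : Matrix (Fin q) (Fin p) ℝ} {Q : Matrix (Fin p) (Fin q) ℝ} {ε : ℝ}
    (hS : ⨆ l, Module.End.eigenspace (toLin' (cpx S)) l = ⊤)
    (hre : ∀ l ∈ (cpx S).charpoly.roots, l.re = 0) (hQ : Q ≠ 0)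
    (hlim : ∀ σ : Signals K q, IsClosedLoopSolution K S Bη Q ε σ → ∀ i,
      Tendsto (fun t => σ.y i t -
        Q *ᵥ (NormedSpace.exp (t • S) *ᵥ ((N : ℝ)⁻¹ • ∑ k, σ.η k 0))) atTop (𝓝 0)) :
    ∃ σ : Signals K q, IsClosedLoopSolution K S Bη Q ε σ ∧
      ∀ i, ¬ Tendsto (σ.y i) atTop (𝓝 0) := by
  obtain ⟨η₀, hη₀⟩ := exists_not_tendsto_mulVec_exp_smul hS hre hQ
  obtain ⟨σ, hσ, hinit⟩ := exists_isClosedLoopSolution_of_exosystem_eq K S Bη Q ε η₀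
  refine ⟨σ, hσ, fun i hi => hη₀ ?_⟩
  have haverage : (N : ℝ)⁻¹ • ∑ k, σ.η k 0 = η₀ := by
    have hN : (N : ℝ) ≠ 0 := by exact_mod_cast i.pos.ne'
    simp only [hinit]
    rw [Finset.sum_const, Finset.card_univ, Fintype.card_fin, ← Nat.cast_smul_eq_nsmul ℝ,
      smul_smul, inv_mul_cancel₀ hN, one_smul]
  simpa [haverage] using hi.sub (hlim σ hσ i)

end DynamicEdgeNetwork

open DynamicEdgeNetwork in
theorem mainTheorem2_general {N M p q : ℕ} (sys : MultiAgentSystem N M p)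
    (K : ControllerGains sys) (S : Matrix (Fin q) (Fin q) ℝ) (Q : Matrix (Fin p) (Fin q) ℝ)
    (P : Matrix (Fin q) (Fin q) ℝ) (Bη : Matrix (Fin q) (Fin p) ℝ)
    (hre : ∀ l ∈ (cpx S).charpoly.roots, l.re = 0)
    (hA3 : ∀ j, IsStrictlyPositiveReal (sys.E j) (sys.F j) (sys.G j))
    (hA4 : sys.IsConnected)
    (hIM : ∀ i, IncorporatesInternalModel S (K.G₁ i) (K.G₂ i))
    (hA5 : ∀ i, IsHurwitz (K.Ahat i) ∧ IsPassive (K.Ahat i) (K.Dhat i) (K.Chat i))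
    (hP : P.PosDef) (hPS : (-(P * S + Sᵀ * P)).PosSemidef)
    (hBη : Bη = P⁻¹ * Qᵀ) :
    ∃ εstar : ℝ, 0 < εstar ∧ ∀ ε : ℝ, 0 < ε → ε < εstar →
      SolvesOutputSynchronization K S Bη Q ε ∧
      ∀ σ : Signals K q, IsClosedLoopSolution K S Bη Q ε σ → ∀ i,
        Tendsto (fun t => σ.y i t -
            Q *ᵥ (NormedSpace.exp (t • S) *ᵥ ((N : ℝ)⁻¹ • ∑ k, σ.η k 0)))
          atTop (𝓝 0) := by
  have hLyap : IsLyapunovMatrix (cpx P) (cpx S) := isLyapunovMatrix_cpx hP hPS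
  have hBηQ : cpx P * cpx Bη = (cpx Q)ᴴ := by
    rw [hBη, cpx_mul_cpx_inv_mul_transpose hP]
  obtain ⟨εstar, hpos, hmodes⟩ := ControllerGains.exists_gain_forall_unstable_mode_isSynchronousMode
    hA3 hA4 hIM hA5 hre hLyap hBηQ
  refine ⟨εstar, hpos, fun ε hε hεstar => ?_⟩
  have hlim (σ : Signals K q) (hσ : IsClosedLoopSolution K S Bη Q ε σ) :=
    hσ.tendsto_output_sub_average hre hLyap hBηQ (hmodes ε hε hεstar)
  refine ⟨⟨fun σ hσ => ?_, fun hQ => ?_⟩, hlim⟩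
  · exact ⟨fun t => NormedSpace.exp (t • S) *ᵥ ((N : ℝ)⁻¹ • ∑ k, σ.η k 0),
      fun t _ => (hasDerivAt_exp_smul_mulVec S _ t).hasDerivWithinAt, hlim σ hσ⟩
  · exact exists_isClosedLoopSolution_forall_not_tendsto (hLyap.iSup_eigenspace_eq_top hre) hre hQ
      hlim

open DynamicEdgeNetwork in
theorem mainTheorem2 {N M p q : ℕ} (sys : MultiAgentSystem N M p) (K : ControllerGains sys)
    (S : Matrix (Fin q) (Fin q) ℝ) (Q : Matrix (Fin p) (Fin q) ℝ)
    (P : Matrix (Fin q) (Fin q) ℝ) (Bη : Matrix (Fin q) (Fin p) ℝ)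
    (hA1 : sys.FullRank)
    (hA2 : HasSimpleImaginarySpectrum S)
    (hA3 : ∀ j, IsStrictlyPositiveReal (sys.E j) (sys.F j) (sys.G j))
    (hA4 : sys.IsConnected)
    (hIM : ∀ i, IncorporatesInternalModel S (K.G₁ i) (K.G₂ i))
    (hA5 : ∀ i, IsHurwitz (K.Ahat i) ∧ IsPassive (K.Ahat i) (K.Dhat i) (K.Chat i))
    (hP : P.PosDef) (hPS : (-(P * S + Sᵀ * P)).PosSemidef)
    (hBη : Bη = P⁻¹ * Qᵀ) :
    ∃ εstar : ℝ, 0 < εstar ∧ ∀ ε : ℝ, 0 < ε → ε < εstar →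
      SolvesOutputSynchronization K S Bη Q ε ∧
      ∀ σ : Signals K q, IsClosedLoopSolution K S Bη Q ε σ → ∀ i,
        Tendsto (fun t => σ.y i t -
            Q *ᵥ (NormedSpace.exp (t • S) *ᵥ ((N : ℝ)⁻¹ • ∑ k, σ.η k 0)))
          atTop (𝓝 0) :=
  mainTheorem2_general sys K S Q P Bη hA2.1 hA3 hA4 hIM hA5 hP hPS hBη
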